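/- **Notation.** Let $\mathbf O$ be the real octonions with unit $1$, conjugation $x\mapsto\overline x$ and inner product $(x|y)=\mathrm{Re}(x\overline y)$. Let $\mathcal J^1$ be the real vector space of all matrices $$h^1(\xi_1,\xi_2,\xi_3;x_1,x_2,x_3)=\begin{pmatrix}\xi_1&\sqrt{-1}\,x_3&\sqrt{-1}\,\overline{x_2}\\ \sqrt{-1}\,\overline{x_3}&\xi_2&x_1\\ \sqrt{-1}\,x_2&\overline{x_1}&\xi_3\end{pmatrix},\qquad \xi_i\in\mathbb R,\ x_i\in\mathbf O,$$ with entries in $\mathbf O\otimes_{\mathbb R}\mathbb C$, with the Jordan product $X\circ Y=\frac12(XY+YX)$, the trace $\mathrm{tr}(X)=\xi_1+\xi_2+\xi_3$ and the inner product $(X|Y)=\mathrm{tr}(X\circ Y)$. Put $E_2=h^1(0,1,0;0,0,0)$ and $P^-=h^1(-1,1,0;0,0,1)$, and $$\mathrm F_{4(-20)}=\{g\in\mathrm{GL}_{\mathbb R}(\mathcal J^1)\mid g(X\circ Y)=gX\circ gY \text{ for all } X,Y\in\mathcal J^1\}$$ with Lie algebra $\mathfrak f=\{D\in\mathrm{End}_{\mathbb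 R}(\mathcal J^1)\mid \exp(tD)\in \mathrm F_{4(-20)}\text{ for all }t\in\mathbb R\}$. For $a\in\mathbf O$, let $\tilde A^1_1(a),\tilde A^1_3(a)\in\mathfrak f$ be the maps $X\mapsto BX-XB$, where $B$ is the $3\times3$ matrix whose only non-zero entries are $B_{23}=a,\ B_{32}=-\overline a$ for $\tilde A^1_1(a)$, and $B_{12}=\sqrt{-1}\,a,\ B_{21}=-\sqrt{-1}\,\overline a$ for $\tilde A_3^1(a)$. Let $\sigma\in\mathrm F_{4(-20)}$ be the involution $h^1(\xi_1,\xi_2,\xi_3;x_1,x_2,x_3)\mapsto h^1(\xi_1,\xi_2,\xi_3;x_1,-x_2,-x_3)$, let $\theta(X)=\sigma X\sigma^{-1}$ on $\mathfrak f$ (a Cartan involution), $\mathfrak k=\{X\in\mathfrak f\mid\theta X=X\}$ and $K=\{g\in \mathrm F_{4(-20)}\mid\sigma g\sigma^{-1}=g\}$. Let $\mathfrak a=\mathbb R\,\tilde A_3^1(1)$, $A=\exp\mathfrak a$, $M=\{k\in K\mid k\tilde A_3^1(1)k^{-1}=\tilde A_3^1(1)\}$ and $\mathfrak m=\{X\in\mathfrak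 k\mid[X,\tilde A_3^1(1)]=0\}$. Let $\alpha$ be the linear functional on $\mathfrak a$ with $\alpha(\tilde A_3^1(1))=1$ and, for a linear functional $\lambda$, let $\mathfrak g_\lambda=\{X\in\mathfrak f\mid[H,X]=\lambda(H)X\text{ for all }H\in\mathfrak a\}$; then $\mathfrak f=\mathfrak g_{-2\alpha}\oplus\mathfrak g_{-\alpha}\oplus\mathfrak a\oplus\mathfrak m\oplus\mathfrak g_\alpha\oplus\mathfrak g_{2\alpha}$. Let $N^+=\exp(\mathfrak g_\alpha\oplus\mathfrak g_{2\alpha})$. Let $\theta_\epsilon$ be the linear map on $\mathfrak f$ that equals $\theta$ on $\mathfrak a\oplus\mathfrak m\oplus\mathfrak g_{2\alpha}\oplus\mathfrak g_{-2\alpha}$ and $-\theta$ on $\mathfrak g_{\alpha}\oplus\mathfrak g_{-\alpha}$. Let $\mathfrak k_\epsilon=\{X\in\mathfrak f\mid\theta_\epsilon X=X\}$, let $(K_\epsilon)^0$ be the connected Lie subgroup of $\mathrm F_{4(-20)}$ with Lie algebra $\mathfrak k_\epsilon$ (the subgroup generated by $\exp\mathfrak k_\epsilon$), and let $K_\epsilon=(K_\epsilon)^0M$.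 **Theorem (explicit Matsuki decomposition of $\mathrm F_{4(-20)}$).** The group $\mathrm F_{4(-20)}$ is the disjoint union $$\mathrm F_{4(-20)}=K_\epsilon MAN^+\ \coprod\ K_\epsilon\exp\left(-2^{-1}\pi\tilde A_1^1(1)\right)MAN^+,$$ where $K_\epsilon MAN^+=K_\epsilon AN^+$ and $$K_\epsilon\exp\left(-2^{-1}\pi\tilde A_1^1(1)\right)MAN^+=\{g\in\mathrm F_{4(-20)}\mid(gP^-|E_2)=0\}.$$ -/

import Mathlib

open scoped Pointwise

noncomputable section

set_option linter.unusedSimpArgs false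

namespace F4m20

/-! ### Octonions -/

/-- The octonion algebra over a commutative ring `R`, with coordinates `c i` with respect to the
basic units `1 = e₀, e₁, …, e₇`.  `Oct ℝ` is the algebra **O** of real octonions, `Oct ℂ` is its
complexification. -/
@[ext]
structure Oct (R : Type) where
  /-- the coordinates -/
  c : Fin 8 → R

namespace Oct

variable {R : Type} [CommRing R]

instance : Zero (Oct R) := ⟨⟨0⟩⟩
instance : One (Oct R) := ⟨⟨![1, 0, 0, 0, 0, 0, 0, 0]⟩⟩
instance : Add (Oct R) := ⟨fun x y => ⟨x.c + y.c⟩⟩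
instance : Neg (Oct R) := ⟨fun x => ⟨-x.c⟩⟩
instance : Sub (Oct R) := ⟨fun x y => ⟨x.c - y.c⟩⟩
instance : SMul R (Oct R) := ⟨fun r x => ⟨r • x.c⟩⟩

/-- The octonion product, i.e. the Cayley-Dickson product `(a, b)(c, d) = (a c - d̄ b, d a + b c̄)`
for pairs of quaternions (the coordinates `0, 1, 2, 3` and `4, 5, 6, 7`). -/
def mul (x y : Oct R) : Oct R := ⟨![
      x.c 0 * y.c 0 - x.c 1 * y.c 1 - x.c 2 * y.c 2 - x.c 3 * y.c 3
        - x.c 4 * y.c 4 - x.c 5 * y.c 5 - x.c 6 * y.c 6 - x.c 7 * y.c 7,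
      x.c 0 * y.c 1 + x.c 1 * y.c 0 + x.c 2 * y.c 3 - x.c 3 * y.c 2
        + x.c 4 * y.c 5 - x.c 5 * y.c 4 - x.c 6 * y.c 7 + x.c 7 * y.c 6,
      x.c 0 * y.c 2 - x.c 1 * y.c 3 + x.c 2 * y.c 0 + x.c 3 * y.c 1
        + x.c 4 * y.c 6 + x.c 5 * y.c 7 - x.c 6 * y.c 4 - x.c 7 * y.c 5,
      x.c 0 * y.c 3 + x.c 1 * y.c 2 - x.c 2 * y.c 1 + x.c 3 * y.c 0
        + x.c 4 * y.c 7 - x.c 5 * y.c 6 + x.c 6 * y.c 5 - x.c 7 * y.c 4,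
      x.c 0 * y.c 4 - x.c 1 * y.c 5 - x.c 2 * y.c 6 - x.c 3 * y.c 7
        + x.c 4 * y.c 0 + x.c 5 * y.c 1 + x.c 6 * y.c 2 + x.c 7 * y.c 3,
      x.c 0 * y.c 5 + x.c 1 * y.c 4 - x.c 2 * y.c 7 + x.c 3 * y.c 6
        - x.c 4 * y.c 1 + x.c 5 * y.c 0 - x.c 6 * y.c 3 + x.c 7 * y.c 2,
      x.c 0 * y.c 6 + x.c 1 * y.c 7 + x.c 2 * y.c 4 - x.c 3 * y.c 5
        - x.c 4 * y.c 2 + x.c 5 * y.c 3 + x.c 6 * y.c 0 - x.c 7 * y.c 1,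
      x.c 0 * y.c 7 - x.c 1 * y.c 6 + x.c 2 * y.c 5 + x.c 3 * y.c 4
        - x.c 4 * y.c 3 - x.c 5 * y.c 2 + x.c 6 * y.c 1 + x.c 7 * y.c 0]⟩

instance : Mul (Oct R) := ⟨mul⟩

/-- The octonion conjugation (linear over `R`). -/
def conj (x : Oct R) : Oct R :=
  ⟨![x.c 0, -x.c 1, -x.c 2, -x.c 3, -x.c 4, -x.c 5, -x.c 6, -x.c 7]⟩

/-- The octonion inner product `(x | y)`, which is the real part of `x ȳ`. -/
def ip (x y : Oct R) : R := ∑ i, x.c i * y.c i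

@[simp] theorem zero_c : (0 : Oct R).c = 0 := rfl
@[simp] theorem one_c : (1 : Oct R).c = ![1, 0, 0, 0, 0, 0, 0, 0] := rfl
@[simp] theorem add_c (x y : Oct R) : (x + y).c = x.c + y.c := rfl
@[simp] theorem neg_c (x : Oct R) : (-x).c = -x.c := rfl
@[simp] theorem sub_c (x y : Oct R) : (x - y).c = x.c - y.c := rfl
@[simp] theorem smul_c (r : R) (x : Oct R) : (r • x).c = r • x.c := rfl

theorem mul_c (x y : Oct R) : (x * y).c = ![
      x.c 0 * y.c 0 - x.c 1 * y.c 1 - x.c 2 * y.c 2 - x.c 3 * y.c 3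
        - x.c 4 * y.c 4 - x.c 5 * y.c 5 - x.c 6 * y.c 6 - x.c 7 * y.c 7,
      x.c 0 * y.c 1 + x.c 1 * y.c 0 + x.c 2 * y.c 3 - x.c 3 * y.c 2
        + x.c 4 * y.c 5 - x.c 5 * y.c 4 - x.c 6 * y.c 7 + x.c 7 * y.c 6,
      x.c 0 * y.c 2 - x.c 1 * y.c 3 + x.c 2 * y.c 0 + x.c 3 * y.c 1
        + x.c 4 * y.c 6 + x.c 5 * y.c 7 - x.c 6 * y.c 4 - x.c 7 * y.c 5,
      x.c 0 * y.c 3 + x.c 1 * y.c 2 - x.c 2 * y.c 1 + x.c 3 * y.c 0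
        + x.c 4 * y.c 7 - x.c 5 * y.c 6 + x.c 6 * y.c 5 - x.c 7 * y.c 4,
      x.c 0 * y.c 4 - x.c 1 * y.c 5 - x.c 2 * y.c 6 - x.c 3 * y.c 7
        + x.c 4 * y.c 0 + x.c 5 * y.c 1 + x.c 6 * y.c 2 + x.c 7 * y.c 3,
      x.c 0 * y.c 5 + x.c 1 * y.c 4 - x.c 2 * y.c 7 + x.c 3 * y.c 6
        - x.c 4 * y.c 1 + x.c 5 * y.c 0 - x.c 6 * y.c 3 + x.c 7 * y.c 2,
      x.c 0 * y.c 6 + x.c 1 * y.c 7 + x.c 2 * y.c 4 - x.c 3 * y.c 5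
        - x.c 4 * y.c 2 + x.c 5 * y.c 3 + x.c 6 * y.c 0 - x.c 7 * y.c 1,
      x.c 0 * y.c 7 - x.c 1 * y.c 6 + x.c 2 * y.c 5 + x.c 3 * y.c 4
        - x.c 4 * y.c 3 - x.c 5 * y.c 2 + x.c 6 * y.c 1 + x.c 7 * y.c 0] := rfl

theorem conj_c (x : Oct R) : (conj x).c =
    ![x.c 0, -x.c 1, -x.c 2, -x.c 3, -x.c 4, -x.c 5, -x.c 6, -x.c 7] := rfl

/-- The quadratic form `(x | x)` is multiplicative. -/
theorem ip_mul_self (x y : Oct R) : ip (x * y) (x * y) = ip x x * ip y y := by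
  simp only [ip, mul_c, Fin.sum_univ_eight, Matrix.cons_val]
  ring

instance : AddCommGroup (Oct R) where
  add_assoc _ _ _ := Oct.ext (add_assoc _ _ _)
  zero_add _ := Oct.ext (zero_add _)
  add_zero _ := Oct.ext (add_zero _)
  add_comm _ _ := Oct.ext (add_comm _ _)
  neg_add_cancel _ := Oct.ext (neg_add_cancel _)
  sub_eq_add_neg _ _ := Oct.ext (sub_eq_add_neg _ _)
  nsmul := nsmulRec
  zsmul := zsmulRec

instance : Module R (Oct R) where
  one_smul _ := Oct.ext (one_smul _ _)
  mul_smul _ _ _ := Oct.ext (mul_smul _ _ _)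
  smul_zero _ := Oct.ext (smul_zero _)
  smul_add _ _ _ := Oct.ext (smul_add _ _ _)
  add_smul _ _ _ := Oct.ext (add_smul _ _ _)
  zero_smul _ := Oct.ext (zero_smul _ _)

theorem ext8 {S : Type} {x y : Oct S} (h0 : x.c 0 = y.c 0) (h1 : x.c 1 = y.c 1) (h2 : x.c 2 = y.c 2)
    (h3 : x.c 3 = y.c 3) (h4 : x.c 4 = y.c 4) (h5 : x.c 5 = y.c 5) (h6 : x.c 6 = y.c 6)
    (h7 : x.c 7 = y.c 7) : x = y :=
  Oct.ext (funext fun i => by fin_cases i <;> assumption)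

instance : NonAssocRing (Oct R) where
  left_distrib x y z := by
    apply ext8 <;> simp only [mul_c, add_c, Pi.add_apply, Matrix.cons_val] <;> ring
  right_distrib x y z := by
    apply ext8 <;> simp only [mul_c, add_c, Pi.add_apply, Matrix.cons_val] <;> ring
  zero_mul x := by
    apply ext8 <;> simp only [mul_c, zero_c, Pi.zero_apply, Matrix.cons_val] <;> ring
  mul_zero x := by
    apply ext8 <;> simp only [mul_c, zero_c, Pi.zero_apply, Matrix.cons_val] <;> ring
  one_mul x := by
    apply ext8 <;> simp only [mul_c, one_c, Matrix.cons_val] <;> ring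
  mul_one x := by
    apply ext8 <;> simp only [mul_c, one_c, Matrix.cons_val] <;> ring

instance : IsScalarTower R (Oct R) (Oct R) where
  smul_assoc r x y := by
    apply ext8 <;>
      simp only [mul_c, smul_c, smul_eq_mul, Pi.smul_apply, Matrix.cons_val] <;> ring

instance : SMulCommClass R (Oct R) (Oct R) where
  smul_comm r x y := by
    apply ext8 <;>
      simp only [mul_c, smul_c, smul_eq_mul, Pi.smul_apply, Matrix.cons_val] <;> ring

theorem conj_add (x y : Oct R) : conj (x + y) = conj x + conj y := by
  apply ext8 <;> simp only [conj_c, add_c, Pi.add_apply, Matrix.cons_val] <;> ring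

theorem conj_sub (x y : Oct R) : conj (x - y) = conj x - conj y := by
  apply ext8 <;> simp only [conj_c, sub_c, Pi.sub_apply, Matrix.cons_val] <;> ring

theorem conj_neg (x : Oct R) : conj (-x) = -conj x := by
  apply ext8 <;> simp only [conj_c, neg_c, Pi.neg_apply, Matrix.cons_val]

theorem ip_add (x y z : Oct R) : ip x (y + z) = ip x y + ip x z := by
  simp only [ip, add_c, Pi.add_apply, mul_add, Finset.sum_add_distrib]

theorem ip_smul (r : R) (x y : Oct R) : ip x (r • y) = r * ip x y := by
  simp only [ip, smul_c, Pi.smul_apply, smul_eq_mul, Finset.mul_sum, mul_left_comm]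

theorem conj_smul (r : R) (x : Oct R) : conj (r • x) = r • conj x := by
  apply ext8 <;> simp only [conj_c, smul_c, smul_eq_mul, Pi.smul_apply, Matrix.cons_val] <;> ring

theorem conj_mul (x y : Oct R) : conj (x * y) = conj y * conj x := by
  apply ext8 <;> simp only [conj_c, mul_c, Matrix.cons_val] <;> ring

theorem mul_conj_add (x y : Oct R) : x * conj y + y * conj x = (2 * ip x y) • 1 := by
  apply ext8 <;>
    simp only [conj_c, mul_c, add_c, smul_c, one_c, ip, smul_eq_mul, Pi.add_apply, Pi.smul_apply,
      Fin.sum_univ_eight, Matrix.cons_val] <;> ring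

theorem conj_mul_add (x y : Oct R) : conj x * y + conj y * x = (2 * ip x y) • 1 := by
  apply ext8 <;>
    simp only [conj_c, mul_c, add_c, smul_c, one_c, ip, smul_eq_mul, Pi.add_apply, Pi.smul_apply,
      Fin.sum_univ_eight, Matrix.cons_val] <;> ring

/-- The coordinates as a linear map. -/
def coord : Oct R →ₗ[R] (Fin 8 → R) where
  toFun x := x.c
  map_add' _ _ := rfl
  map_smul' _ _ := rfl

theorem coord_injective : Function.Injective (coord : Oct R →ₗ[R] (Fin 8 → R)) :=
  fun _ _ h => Oct.ext h

/-! The norm only serves to give the real octonions their vector space topology. -/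

instance : NormedAddCommGroup (Oct ℝ) :=
  NormedAddCommGroup.induced (Oct ℝ) (Fin 8 → ℝ) (coord (R := ℝ)) coord_injective

instance : NormedSpace ℝ (Oct ℝ) :=
  NormedSpace.induced ℝ (Oct ℝ) (Fin 8 → ℝ) (coord (R := ℝ))

instance : FiniteDimensional ℝ (Oct ℝ) :=
  Module.Finite.of_injective (coord (R := ℝ)) coord_injective

/-- The inclusion of the real octonions in the complex ones. -/
def cplx (x : Oct ℝ) : Oct ℂ := ⟨fun i => x.c i⟩

@[simp] theorem cplx_c (x : Oct ℝ) (i : Fin 8) : x.cplx.c i = x.c i := rfl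

theorem cplx_add (x y : Oct ℝ) : (x + y).cplx = x.cplx + y.cplx :=
  Oct.ext (funext fun i => Complex.ofReal_add (x.c i) (y.c i))

theorem cplx_sub (x y : Oct ℝ) : (x - y).cplx = x.cplx - y.cplx :=
  Oct.ext (funext fun i => Complex.ofReal_sub (x.c i) (y.c i))

theorem cplx_neg (x : Oct ℝ) : (-x).cplx = -x.cplx :=
  Oct.ext (funext fun i => Complex.ofReal_neg (x.c i))

theorem cplx_zero : (0 : Oct ℝ).cplx = 0 :=
  Oct.ext (funext fun _ => Complex.ofReal_zero)

theorem cplx_smul (r : ℝ) (x : Oct ℝ) : (r • x).cplx = (r : ℂ) • x.cplx :=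
  Oct.ext (funext fun i => Complex.ofReal_mul r (x.c i))

theorem cplx_mul (x y : Oct ℝ) : (x * y).cplx = x.cplx * y.cplx := by
  apply ext8 <;> simp only [cplx_c, mul_c, Matrix.cons_val] <;> push_cast <;> rfl

theorem cplx_conj (x : Oct ℝ) : x.conj.cplx = x.cplx.conj := by
  apply ext8 <;> simp only [cplx_c, conj_c, Matrix.cons_val] <;> push_cast <;> rfl

theorem cplx_ip (x y : Oct ℝ) : ((ip x y : ℝ) : ℂ) = ip x.cplx y.cplx := by
  simp only [ip, cplx_c]
  push_cast
  rfl

theorem conj_conj (x : Oct R) : conj (conj x) = x := by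
  apply ext8 <;> simp only [conj_c, Matrix.cons_val, neg_neg]

attribute [irreducible] mul conj cplx ip

end Oct

/-! ### The exceptional Jordan algebra -/

/-- The real vector space of the exceptional Jordan algebra `𝒥¹`; the element
`h¹(ξ₁, ξ₂, ξ₃; x₁, x₂, x₃)` is represented by its coordinates `(ξ, x)`, where the indices
`1, 2, 3` are written `0, 1, 2`. -/
abbrev J : Type := (Fin 3 → ℝ) × (Fin 3 → Oct ℝ)

/-- The element `h¹(ξ₁, ξ₂, ξ₃; x₁, x₂, x₃)`. -/
def h1 (a b c : ℝ) (x y z : Oct ℝ) : J := (![a, b, c], ![x, y, z])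

theorem h1_add (a b c a' b' c' : ℝ) (x y z x' y' z' : Oct ℝ) :
    h1 a b c x y z + h1 a' b' c' x' y' z' =
      h1 (a + a') (b + b') (c + c') (x + x') (y + y') (z + z') := by
  refine Prod.ext (funext fun i => ?_) (funext fun i => ?_) <;> fin_cases i <;> rfl

theorem smul_h1 (r a b c : ℝ) (x y z : Oct ℝ) :
    r • h1 a b c x y z = h1 (r * a) (r * b) (r * c) (r • x) (r • y) (r • z) := by
  refine Prod.ext (funext fun i => ?_) (funext fun i => ?_) <;> fin_cases i <;> rfl

/-- The Hermitian-type matrix with octonion entries (over `ℂ`) that the coordinates stand for. -/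
def toMatrix (X : J) : Matrix (Fin 3) (Fin 3) (Oct ℂ) :=
  !![(X.1 0 : ℂ) • 1, Complex.I • (X.2 2).cplx, Complex.I • (X.2 1).conj.cplx;
     Complex.I • (X.2 2).conj.cplx, (X.1 1 : ℂ) • 1, (X.2 0).cplx;
     Complex.I • (X.2 1).cplx, (X.2 0).conj.cplx, (X.1 2 : ℂ) • 1]

/-- The Jordan product `X ∘ Y = (X Y + Y X) / 2`, in coordinates (see `toMatrix_jmul`). -/
def jmul (X Y : J) : J :=
  h1 (X.1 0 * Y.1 0 - (X.2 1).ip (Y.2 1) - (X.2 2).ip (Y.2 2))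
    (X.1 1 * Y.1 1 + (X.2 0).ip (Y.2 0) - (X.2 2).ip (Y.2 2))
    (X.1 2 * Y.1 2 + (X.2 0).ip (Y.2 0) - (X.2 1).ip (Y.2 1))
    ((1 / 2 : ℝ) • ((X.1 1 + X.1 2) • Y.2 0 + (Y.1 1 + Y.1 2) • X.2 0
      - (X.2 1 * Y.2 2 + Y.2 1 * X.2 2).conj))
    ((1 / 2 : ℝ) • ((X.1 2 + X.1 0) • Y.2 1 + (Y.1 2 + Y.1 0) • X.2 1
      + (X.2 2 * Y.2 0 + Y.2 2 * X.2 0).conj))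
    ((1 / 2 : ℝ) • ((X.1 0 + X.1 1) • Y.2 2 + (Y.1 0 + Y.1 1) • X.2 2
      + (X.2 0 * Y.2 1 + Y.2 0 * X.2 1).conj))

theorem toMatrix_injective : Function.Injective toMatrix := by
  intro X Y h
  have hm : ∀ i j, toMatrix X i j = toMatrix Y i j := fun i j => by rw [h]
  have key : ∀ a b : Oct ℝ, a.cplx = b.cplx → a = b := fun a b hab =>
    Oct.ext (funext fun i => Complex.ofReal_injective (by
      rw [← Oct.cplx_c, ← Oct.cplx_c, hab]))
  have keyI : ∀ a b : Oct ℂ, Complex.I • a = Complex.I • b → a = b := fun a b hab => by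
    have := congrArg (fun z => (-Complex.I) • z) hab
    simpa [smul_smul] using this
  have keyr : ∀ a b : ℝ, (a : ℂ) • (1 : Oct ℂ) = (b : ℂ) • 1 → a = b := by
    intro a b hab
    have e1 := congrArg (fun z : Oct ℂ => z.c 0) hab
    simpa [-Complex.coe_smul] using e1
  refine Prod.ext (funext fun i => ?_) (funext fun i => ?_)
  · fin_cases i
    · exact keyr _ _ (hm 0 0)
    · exact keyr _ _ (hm 1 1)
    · exact keyr _ _ (hm 2 2)
  · fin_cases i
    · exact key _ _ (hm 1 2)
    · exact key _ _ (keyI _ _ (hm 2 0))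
    · exact key _ _ (keyI _ _ (hm 0 1))

theorem ip_smul_one (x y : Oct ℂ) :
    Oct.ip x y • (1 : Oct ℂ) = (1 / 2 : ℂ) • (x * y.conj + y * x.conj) := by
  rw [Oct.mul_conj_add, smul_smul]
  congr 1
  ring

theorem ip_smul_one' (x y : Oct ℂ) :
    Oct.ip x y • (1 : Oct ℂ) = (1 / 2 : ℂ) • (x.conj * y + y.conj * x) := by
  rw [Oct.conj_mul_add, smul_smul]
  congr 1
  ring

theorem matrix_ext {A B : Matrix (Fin 3) (Fin 3) (Oct ℂ)} (h00 : A 0 0 = B 0 0)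
    (h01 : A 0 1 = B 0 1) (h02 : A 0 2 = B 0 2) (h10 : A 1 0 = B 1 0) (h11 : A 1 1 = B 1 1)
    (h12 : A 1 2 = B 1 2) (h20 : A 2 0 = B 2 0) (h21 : A 2 1 = B 2 1) (h22 : A 2 2 = B 2 2) :
    A = B := by
  ext1 i j
  fin_cases i <;> fin_cases j <;> assumption

theorem toMatrix_00 (X : J) : toMatrix X 0 0 = (X.1 0 : ℂ) • 1 := rfl
theorem toMatrix_01 (X : J) : toMatrix X 0 1 = Complex.I • (X.2 2).cplx := rfl
theorem toMatrix_02 (X : J) : toMatrix X 0 2 = Complex.I • (X.2 1).conj.cplx := rfl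
theorem toMatrix_10 (X : J) : toMatrix X 1 0 = Complex.I • (X.2 2).conj.cplx := rfl
theorem toMatrix_11 (X : J) : toMatrix X 1 1 = (X.1 1 : ℂ) • 1 := rfl
theorem toMatrix_12 (X : J) : toMatrix X 1 2 = (X.2 0).cplx := rfl
theorem toMatrix_20 (X : J) : toMatrix X 2 0 = Complex.I • (X.2 1).cplx := rfl
theorem toMatrix_21 (X : J) : toMatrix X 2 1 = (X.2 0).conj.cplx := rfl
theorem toMatrix_22 (X : J) : toMatrix X 2 2 = (X.1 2 : ℂ) • 1 := rfl

theorem toMatrix_jmul (X Y : J) :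
    toMatrix (jmul X Y) =
      (1 / 2 : ℂ) • (toMatrix X * toMatrix Y + toMatrix Y * toMatrix X) := by
  have hI : Complex.I * Complex.I = -1 := Complex.I_mul_I
  have e0 := ip_smul_one (X.2 0).cplx (Y.2 0).cplx
  have e0' := ip_smul_one' (X.2 0).cplx (Y.2 0).cplx
  have e1 := ip_smul_one (X.2 1).cplx (Y.2 1).cplx
  have e1' := ip_smul_one' (X.2 1).cplx (Y.2 1).cplx
  have e2 := ip_smul_one (X.2 2).cplx (Y.2 2).cplx
  have e2' := ip_smul_one' (X.2 2).cplx (Y.2 2).cplx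
  refine matrix_ext ?_ ?_ ?_ ?_ ?_ ?_ ?_ ?_ ?_ <;>
  simp only [Matrix.smul_apply, Matrix.add_apply, Matrix.mul_apply, Fin.sum_univ_three,
    toMatrix_00, toMatrix_01, toMatrix_02, toMatrix_10, 
    toMatrix_11, toMatrix_12, toMatrix_20, toMatrix_21, toMatrix_22]
  all_goals
    simp only [jmul, h1, Matrix.cons_val, Oct.cplx_add, Oct.cplx_sub,
      Oct.cplx_smul, Oct.cplx_mul, Oct.cplx_conj, smul_mul_assoc, mul_smul_comm, mul_one, one_mul,
      smul_smul, hI, Oct.conj_add, Oct.conj_sub, Oct.conj_mul, Oct.conj_conj, Oct.conj_smul,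
      Complex.ofReal_add, Complex.ofReal_sub, Complex.ofReal_mul, Complex.ofReal_div,
      Complex.ofReal_one, Complex.ofReal_ofNat, Oct.cplx_ip, add_smul, sub_smul]
  · rw [e1', e2]
    module
  · module
  · module
  · module
  · rw [e0, e2']
    module
  · module
  · module
  · module
  · rw [e0', e1]
    module

/-- The trace `tr X = ξ₁ + ξ₂ + ξ₃`. -/
def tr (X : J) : ℝ := X.1 0 + X.1 1 + X.1 2

/-- The inner product `(X | Y) = tr (X ∘ Y)`. -/
def inn (X Y : J) : ℝ := tr (jmul X Y)

/-- The element `E₂`. -/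
def E2 : J := h1 0 1 0 0 0 0

/-- The element `P⁻ = h¹(-1, 1, 0; 0, 0, 1)`. -/
def Pminus : J := h1 (-1) 1 0 0 0 1

/-! ### The group and its Lie algebra -/

/-- The (continuous) real linear endomorphisms of `𝒥¹`. -/
abbrev EndJ : Type := J →L[ℝ] J

/-- The exponential map from the endomorphisms to `GL(𝒥¹) = EndJˣ`. -/
def expU (D : EndJ) : EndJˣ where
  val := NormedSpace.exp D
  inv := NormedSpace.exp (-D)
  val_inv := by
    let _ : NormedAlgebra ℚ EndJ := NormedAlgebra.restrictScalars ℚ ℝ EndJ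
    rw [← NormedSpace.exp_add_of_commute ((Commute.refl D).neg_right), add_neg_cancel,
      NormedSpace.exp_zero]
  inv_val := by
    let _ : NormedAlgebra ℚ EndJ := NormedAlgebra.restrictScalars ℚ ℝ EndJ
    rw [← NormedSpace.exp_add_of_commute ((Commute.refl D).neg_left), neg_add_cancel,
      NormedSpace.exp_zero]

/-- The group `F₄₍₋₂₀₎` of all automorphisms of the Jordan algebra `𝒥¹`. -/
def F4 : Subgroup EndJˣ where
  carrier := {g | ∀ X Y : J, (g : EndJ) (jmul X Y) = jmul ((g : EndJ) X) ((g : EndJ) Y)}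
  mul_mem' {a b} ha hb X Y := by
    simp only [Set.mem_ofPred_eq, Units.val_mul, mul_apply_eq_comp] at *
    rw [hb, ha]
  one_mem' X Y := rfl
  inv_mem' {a} ha X Y := by
    have l : ∀ Z, (a : EndJ) (((a⁻¹ : EndJˣ) : EndJ) Z) = Z := fun Z => by
      rw [← mul_apply_eq_comp, Units.mul_inv, one_apply_eq_self]
    have r : ∀ Z, ((a⁻¹ : EndJˣ) : EndJ) ((a : EndJ) Z) = Z := fun Z => by
      rw [← mul_apply_eq_comp, Units.inv_mul, one_apply_eq_self]
    have h := ha (((a⁻¹ : EndJˣ) : EndJ) X) (((a⁻¹ : EndJˣ) : EndJ) Y)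
    rw [l, l] at h
    rw [← h, r]

/-- The Lie algebra of the closed linear group `F₄₍₋₂₀₎`: the endomorphisms `D` with
`exp (t D) ∈ F₄₍₋₂₀₎` for all real `t`. -/
def f4 : Set EndJ := {D | ∀ t : ℝ, expU (t • D) ∈ F4}

/-- The linear map underlying `σ = σ₁`: it fixes `ξ₁, ξ₂, ξ₃, x₁` and negates `x₂, x₃`. -/
def sigmaLin : J →ₗ[ℝ] J where
  toFun X := h1 (X.1 0) (X.1 1) (X.1 2) (X.2 0) (-X.2 1) (-X.2 2)
  map_add' X Y := by
    refine Prod.ext (funext fun i => ?_) (funext fun i => ?_) <;> fin_cases i <;>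
      simp [h1, add_comm]
  map_smul' r X := by
    refine Prod.ext (funext fun i => ?_) (funext fun i => ?_) <;> fin_cases i <;> simp [h1]

theorem sigmaLin_sigmaLin (X : J) : sigmaLin (sigmaLin X) = X := by
  refine Prod.ext (funext fun i => ?_) (funext fun i => ?_) <;> fin_cases i <;>
    simp [sigmaLin, h1]

/-- The involution `σ = σ₁` of `𝒥¹`. -/
def sigma : EndJˣ where
  val := LinearMap.toContinuousLinearMap sigmaLin
  inv := LinearMap.toContinuousLinearMap sigmaLin
  val_inv := ContinuousLinearMap.ext sigmaLin_sigmaLin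
  inv_val := ContinuousLinearMap.ext sigmaLin_sigmaLin

/-- The linear map underlying `Ã₁¹(a)`; on matrices it is a commutator, see `toMatrix_A1`. -/
def A1Lin (a : Oct ℝ) : J →ₗ[ℝ] J where
  toFun X := h1 0 (2 * a.ip (X.2 0)) (-2 * a.ip (X.2 0))
    ((X.1 2 - X.1 1) • a) (-(X.2 2 * a).conj) (a * X.2 1).conj
  map_add' X Y := by
    rw [h1_add]
    congr 1 <;> try simp only [Prod.fst_add, Prod.snd_add, Pi.add_apply, Oct.ip_add, Oct.conj_add,
      add_mul, mul_add]
    all_goals module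
  map_smul' r X := by
    rw [RingHom.id_apply, smul_h1]
    congr 1 <;> simp only [Prod.smul_fst, Prod.smul_snd, Pi.smul_apply, Oct.ip_smul,
      Oct.conj_smul, smul_mul_assoc, mul_smul_comm, smul_eq_mul, mul_zero, mul_left_comm, ← mul_sub,
      mul_smul, smul_neg]

/-- The linear map underlying `Ã₃¹(a)`; on matrices it is a commutator, see `toMatrix_A3`. -/
def A3Lin (a : Oct ℝ) : J →ₗ[ℝ] J where
  toFun X := h1 (-2 * a.ip (X.2 2)) (2 * a.ip (X.2 2)) 0
    (X.2 1 * a).conj (a * X.2 0).conj ((X.1 1 - X.1 0) • a)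
  map_add' X Y := by
    rw [h1_add]
    congr 1 <;> try simp only [Prod.fst_add, Prod.snd_add, Pi.add_apply, Oct.ip_add, Oct.conj_add,
      add_mul, mul_add]
    all_goals module
  map_smul' r X := by
    rw [RingHom.id_apply, smul_h1]
    congr 1 <;> simp only [Prod.smul_fst, Prod.smul_snd, Pi.smul_apply, Oct.ip_smul,
      Oct.conj_smul, smul_mul_assoc, mul_smul_comm, smul_eq_mul, mul_zero, mul_left_comm, ← mul_sub,
      mul_smul, smul_neg]

/-- The matrix `A₁¹(a)`. -/
def A1Mat (a : Oct ℝ) : Matrix (Fin 3) (Fin 3) (Oct ℂ) :=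
  !![0, 0, 0; 0, 0, a.cplx; 0, -a.conj.cplx, 0]

theorem A1Mat_00 (a : Oct ℝ) : A1Mat a 0 0 = 0 := rfl
theorem A1Mat_01 (a : Oct ℝ) : A1Mat a 0 1 = 0 := rfl
theorem A1Mat_02 (a : Oct ℝ) : A1Mat a 0 2 = 0 := rfl
theorem A1Mat_10 (a : Oct ℝ) : A1Mat a 1 0 = 0 := rfl
theorem A1Mat_11 (a : Oct ℝ) : A1Mat a 1 1 = 0 := rfl
theorem A1Mat_12 (a : Oct ℝ) : A1Mat a 1 2 = a.cplx := rfl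
theorem A1Mat_20 (a : Oct ℝ) : A1Mat a 2 0 = 0 := rfl
theorem A1Mat_21 (a : Oct ℝ) : A1Mat a 2 1 = -a.conj.cplx := rfl
theorem A1Mat_22 (a : Oct ℝ) : A1Mat a 2 2 = 0 := rfl

theorem toMatrix_A1 (a : Oct ℝ) (X : J) :
    toMatrix (A1Lin a X) = A1Mat a * toMatrix X - toMatrix X * A1Mat a := by
  have e := ip_smul_one a.cplx (X.2 0).cplx
  have e' := ip_smul_one' a.cplx (X.2 0).cplx
  have hI : Complex.I * Complex.I = -1 := Complex.I_mul_I
  refine matrix_ext ?_ ?_ ?_ ?_ ?_ ?_ ?_ ?_ ?_ <;>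
  simp only [Matrix.sub_apply, Matrix.mul_apply, Fin.sum_univ_three,
    toMatrix_00, toMatrix_01, toMatrix_02, toMatrix_10, 
    toMatrix_11, toMatrix_12, toMatrix_20, toMatrix_21, toMatrix_22,
    A1Mat_00, A1Mat_01, A1Mat_02, A1Mat_10, A1Mat_11, A1Mat_12,
    A1Mat_20, A1Mat_21, A1Mat_22]
  all_goals
    simp only [A1Lin, LinearMap.coe_mk, AddHom.coe_mk, h1, Matrix.cons_val, Oct.cplx_sub,
      Oct.cplx_neg, Oct.cplx_smul, Oct.cplx_mul, Oct.cplx_conj, Oct.conj_neg, Oct.conj_mul,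
      Oct.conj_conj, Oct.conj_smul, Oct.cplx_ip, smul_mul_assoc, mul_smul_comm, mul_one, one_mul,
      mul_zero, zero_mul, mul_neg, neg_mul, smul_smul, hI, Complex.ofReal_sub, Complex.ofReal_mul,
      Complex.ofReal_neg, Complex.ofReal_ofNat, Complex.ofReal_zero, neg_smul, smul_neg]
  · module
  · module
  · module
  · module
  · rw [mul_smul, e]; module
  · module
  · module
  · module
  · rw [mul_smul, e']; module

/-- The matrix `A₃¹(a)`. -/
def A3Mat (a : Oct ℝ) : Matrix (Fin 3) (Fin 3) (Oct ℂ) :=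
  !![0, Complex.I • a.cplx, 0; -Complex.I • a.conj.cplx, 0, 0; 0, 0, 0]

theorem A3Mat_00 (a : Oct ℝ) : A3Mat a 0 0 = 0 := rfl
theorem A3Mat_01 (a : Oct ℝ) : A3Mat a 0 1 = Complex.I • a.cplx := rfl
theorem A3Mat_02 (a : Oct ℝ) : A3Mat a 0 2 = 0 := rfl
theorem A3Mat_10 (a : Oct ℝ) : A3Mat a 1 0 = -Complex.I • a.conj.cplx := rfl
theorem A3Mat_11 (a : Oct ℝ) : A3Mat a 1 1 = 0 := rfl
theorem A3Mat_12 (a : Oct ℝ) : A3Mat a 1 2 = 0 := rfl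
theorem A3Mat_20 (a : Oct ℝ) : A3Mat a 2 0 = 0 := rfl
theorem A3Mat_21 (a : Oct ℝ) : A3Mat a 2 1 = 0 := rfl
theorem A3Mat_22 (a : Oct ℝ) : A3Mat a 2 2 = 0 := rfl

theorem toMatrix_A3 (a : Oct ℝ) (X : J) :
    toMatrix (A3Lin a X) = A3Mat a * toMatrix X - toMatrix X * A3Mat a := by
  have e := ip_smul_one a.cplx (X.2 2).cplx
  have e' := ip_smul_one' a.cplx (X.2 2).cplx
  have hI : Complex.I * Complex.I = -1 := Complex.I_mul_I
  refine matrix_ext ?_ ?_ ?_ ?_ ?_ ?_ ?_ ?_ ?_ <;>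
  simp only [Matrix.sub_apply, Matrix.mul_apply, Fin.sum_univ_three,
    toMatrix_00, toMatrix_01, toMatrix_02, toMatrix_10, 
    toMatrix_11, toMatrix_12, toMatrix_20, toMatrix_21, toMatrix_22,
    A3Mat_00, A3Mat_01, A3Mat_02, A3Mat_10, A3Mat_11, A3Mat_12,
    A3Mat_20, A3Mat_21, A3Mat_22]
  all_goals
    simp only [A3Lin, LinearMap.coe_mk, AddHom.coe_mk, h1, Matrix.cons_val, Oct.cplx_sub,
      Oct.cplx_neg, Oct.cplx_smul, Oct.cplx_mul, Oct.cplx_conj, Oct.conj_neg, Oct.conj_mul,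
      Oct.conj_conj, Oct.conj_smul, Oct.cplx_ip, smul_mul_assoc, mul_smul_comm, mul_one, one_mul,
      mul_zero, zero_mul, mul_neg, neg_mul, smul_smul, hI, Complex.ofReal_sub, Complex.ofReal_mul,
      Complex.ofReal_neg, Complex.ofReal_ofNat, Complex.ofReal_zero, neg_smul, smul_neg]
  · rw [mul_smul, e]; module
  · module
  · module
  · module
  · rw [mul_smul, e']; module
  · module
  · module
  · module
  · module

/-- The element `Ã₁¹(a)` of the Lie algebra. -/
def A1 (a : Oct ℝ) : EndJ := LinearMap.toContinuousLinearMap (A1Lin a)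

/-- The element `Ã₃¹(a)` of the Lie algebra. -/
def A3 (a : Oct ℝ) : EndJ := LinearMap.toContinuousLinearMap (A3Lin a)

/-- The Lie bracket `[X, Y] = X Y - Y X`. -/
def brk (X Y : EndJ) : EndJ := X * Y - Y * X

/-- The Cartan involution `θ`, the differential `X ↦ σ X σ⁻¹` of `σ̃ : g ↦ σ g σ⁻¹`. -/
def theta (X : EndJ) : EndJ := (sigma : EndJ) * X * ((sigma⁻¹ : EndJˣ) : EndJ)

/-- The maximal compact subgroup `K`, the fixed point group of `σ̃`. -/
def grpK : Set EndJˣ := {g | g ∈ F4 ∧ sigma * g * sigma⁻¹ = g}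

/-- The abelian Lie algebra `𝔞 = ℝ Ã₃¹(1)`. -/
def lieA : Set EndJ := {X | ∃ t : ℝ, X = t • A3 1}

/-- `A = exp 𝔞`. -/
def grpA : Set EndJˣ := expU '' lieA

/-- `M`, the centralizer of `𝔞` in `K`. -/
def grpM : Set EndJˣ := {k | k ∈ grpK ∧ (k : EndJ) * A3 1 * ((k⁻¹ : EndJˣ) : EndJ) = A3 1}

/-- `𝔪`, the centralizer of `𝔞` in `𝔨 = {X | θ X = X}`. -/
def lieM : Set EndJ := {X | X ∈ f4 ∧ theta X = X ∧ brk X (A3 1) = 0}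

/-- The root space `𝔤_{cα} = {X | [H, X] = cα(H) X for all H ∈ 𝔞}`, where `α(t Ã₃¹(1)) = t`.
The roots of `(𝔣₄₍₋₂₀₎, 𝔞)` are `±α, ±2α`; the positive ones are `α, 2α`. -/
def rootSpace (c : ℝ) : Set EndJ := {X | X ∈ f4 ∧ ∀ t : ℝ, brk (t • A3 1) X = (c * t) • X}

/-- `𝔫⁺ = 𝔤_α + 𝔤_{2α}`. -/
def lieN : Set EndJ := rootSpace 1 + rootSpace 2

/-- `N⁺ = exp 𝔫⁺`. -/
def grpN : Set EndJˣ := expU '' lieN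

/-- `ThetaEps X Y` means `θ_ε X = Y`, where `θ_ε` is the linear map on
`𝔣₄₍₋₂₀₎ = 𝔤_{-2α} ⊕ 𝔤_{-α} ⊕ 𝔞 ⊕ 𝔪 ⊕ 𝔤_α ⊕ 𝔤_{2α}` that is equal to `θ` on `𝔞 ⊕ 𝔪` and to
`ε(λ) θ` on `𝔤_λ`, for the signature of roots `ε(±α) = -1`, `ε(±2α) = 1`. -/
def ThetaEps (X Y : EndJ) : Prop :=
  ∃ H ∈ lieA, ∃ D ∈ lieM, ∃ U₁ ∈ rootSpace 1, ∃ U₂ ∈ rootSpace 2,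
    ∃ V₁ ∈ rootSpace (-1), ∃ V₂ ∈ rootSpace (-2),
      X = H + D + U₁ + U₂ + V₁ + V₂ ∧
      Y = theta H + theta D + (-1 : ℝ) • theta U₁ + (1 : ℝ) • theta U₂
        + (-1 : ℝ) • theta V₁ + (1 : ℝ) • theta V₂

/-- `θ_ε X` is determined by `X`. -/
theorem ThetaEps.unique {X Y Y' : EndJ} (h : ThetaEps X Y) (h' : ThetaEps X Y') : Y = Y' := by
  let T : EndJ →ₗ[ℝ] EndJ := LinearMap.mulLeft ℝ (A3 1) - LinearMap.mulRight ℝ (A3 1)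
  have hT : ∀ P, T P = brk (A3 1) P := fun P => rfl
  have rs : ∀ {c : ℝ} {U : EndJ}, U ∈ rootSpace c → T U = c • U := fun {c U} hU => by
    rw [hT]
    simpa only [one_smul, mul_one] using hU.2 1
  have hz : ∀ {H D : EndJ}, H ∈ lieA → D ∈ lieM → T (H + D) = 0 := by
    rintro H D ⟨t, rfl⟩ hD
    have hD' : D * A3 1 = A3 1 * D := sub_eq_zero.mp hD.2.2
    rw [map_add, map_smul, hT, hT, brk, brk, sub_self, smul_zero, zero_add, hD', sub_self]
  obtain ⟨H, hH, D, hD, U₁, hU₁, U₂, hU₂, V₁, hV₁, V₂, hV₂, rfl, rfl⟩ := h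
  obtain ⟨H', hH', D', hD', U₁', hU₁', U₂', hU₂', V₁', hV₁', V₂', hV₂', e, rfl⟩ := h'
  have z := hz hH hD
  have z' := hz hH' hD'
  have tadd : ∀ P Q : EndJ, theta P + theta Q = theta (P + Q) := fun P Q => by
    simp only [theta, mul_add, add_mul]
  generalize hZ : H + D = Z at e z
  generalize hZ' : H' + D' = Z' at e z'
  have k1 := congrArg T e
  simp only [map_add, z, z', rs hU₁, rs hU₂, rs hV₁, rs hV₂, rs hU₁', rs hU₂', rs hV₁',
    rs hV₂', zero_add] at k1
  have k2 := congrArg T k1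
  simp only [map_add, map_smul, rs hU₁, rs hU₂, rs hV₁, rs hV₂, rs hU₁', rs hU₂', rs hV₁',
    rs hV₂'] at k2
  have k3 := congrArg T k2
  simp only [map_add, map_smul, rs hU₁, rs hU₂, rs hV₁, rs hV₂, rs hU₁', rs hU₂', rs hV₁',
    rs hV₂'] at k3
  have k4 := congrArg T k3
  simp only [map_add, map_smul, rs hU₁, rs hU₂, rs hV₁, rs hV₂, rs hU₁', rs hU₂', rs hV₁',
    rs hV₂'] at k4
  have a1 : U₁ = U₁' := by
    linear_combination (norm := module) (-1 / 6 : ℝ) • k4 + (-1 / 6 : ℝ) • k3 + (4 / 6 : ℝ) • k2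
      + (4 / 6 : ℝ) • k1
  have a2 : V₁ = V₁' := by
    linear_combination (norm := module) (-1 / 6 : ℝ) • k4 + (1 / 6 : ℝ) • k3 + (4 / 6 : ℝ) • k2
      + (-4 / 6 : ℝ) • k1
  have a3 : U₂ = U₂' := by
    linear_combination (norm := module) (1 / 24 : ℝ) • k4 + (2 / 24 : ℝ) • k3 + (-1 / 24 : ℝ) • k2
      + (-2 / 24 : ℝ) • k1
  have a4 : V₂ = V₂' := by
    linear_combination (norm := module) (1 / 24 : ℝ) • k4 + (-2 / 24 : ℝ) • k3 + (-1 / 24 : ℝ) • k2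
      + (2 / 24 : ℝ) • k1
  subst a1 a2 a3 a4
  have a5 : Z = Z' := by simpa using e
  rw [tadd, tadd, hZ, hZ', a5]

/-- `𝔨_ε`, the fixed point set of `θ_ε`. -/
def lieKeps : Set EndJ := {X | ThetaEps X X}

/-- `(K_ε)⁰`, the connected Lie subgroup with Lie algebra `𝔨_ε`, i.e. the subgroup generated by
`exp 𝔨_ε`. -/
def grpKeps0 : Subgroup EndJˣ := Subgroup.closure (expU '' lieKeps)

/-- `K_ε = (K_ε)⁰ M`. -/
def grpKeps : Set EndJˣ := (grpKeps0 : Set EndJˣ) * grpM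

end F4m20

end

open F4m20

open scoped Pointwise

noncomputable section

set_option linter.unusedSimpArgs false

namespace F4m20

/-! ### Coordinates -/

/-! The group acts on the nonzero solutions of `X ∘ X = 0`, and `P⁻` is one of them. The stabilizer
of the line through `P⁻` is `M A N⁺`, so a double coset of `K_ε` and `M A N⁺` amounts to a
`K_ε`-orbit of lines `g (ℝ P⁻)`. The decomposition says that there are two orbits, separated by
whether `ξ₂ = (X | E₂)` vanishes.

Invariance of `ξ₂`: a fixed point of `θ_ε` has no component in `𝔞`, its part in the roots `±2α` is
`θ`-even, and its part in the roots `±α` is `θ`-odd. Together with the weights of `Ã₃¹(1)` on `𝒥¹`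
this forces `𝔨_ε` to kill `E₂` (`lieKeps_E2`). The group `M` also fixes `E₂`, and an automorphism
fixing `E₂` preserves `ξ₂` (`xi_of_fix_E2`).

Transitivity: one-parameter groups of `𝔨_ε` suffice. Hyperbolic rotations `exp (t A2 b)` remove
`x₂`, and `exp (t rot p)` turns the remaining octonion coordinate into a real one. Square-zero
elements thus reach a multiple of `P⁻` if `ξ₂ ≠ 0` (`exists_Keps_smul_Pminus`), and a multiple of
the image of `P⁻` under `exp (-(π/2) Ã₁¹(1))` if `ξ₂ = 0` (`exists_Keps_smul_of_xi_eq_zero`).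

Stabilizer: if `g P⁻ = s P⁻` with `s ≠ 0`, then `s > 0` (`pos_of_Pminus_smul`), so an element of `A`
reduces to `s = 1`. Then `g⁻¹ E₁` is a primitive idempotent whose pairing with `P⁻` is `-1`, and
`N⁺` moves it to `E₁` (`stabilizer_Pminus`). What remains fixes `E₁` and `P⁻`. Since `σ` and
`Ã₃¹(1)` are polynomials in the Jordan multiplications by `E₁` and `F3`, it lies in `M`
(`mem_grpM_of_fix`). -/

theorem J_ext {X Y : J} (h0 : X.1 0 = Y.1 0) (h1 : X.1 1 = Y.1 1) (h2 : X.1 2 = Y.1 2)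
    (k0 : X.2 0 = Y.2 0) (k1 : X.2 1 = Y.2 1) (k2 : X.2 2 = Y.2 2) : X = Y :=
  Prod.ext (funext fun i => by fin_cases i <;> assumption)
    (funext fun i => by fin_cases i <;> assumption)

theorem h1_eta (X : J) : h1 (X.1 0) (X.1 1) (X.1 2) (X.2 0) (X.2 1) (X.2 2) = X :=
  J_ext rfl rfl rfl rfl rfl rfl

@[simp] theorem h1_xi0 (a b c : ℝ) (x y z : Oct ℝ) : (h1 a b c x y z).1 0 = a := rfl
@[simp] theorem h1_xi1 (a b c : ℝ) (x y z : Oct ℝ) : (h1 a b c x y z).1 1 = b := rfl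
@[simp] theorem h1_xi2 (a b c : ℝ) (x y z : Oct ℝ) : (h1 a b c x y z).1 2 = c := rfl
@[simp] theorem h1_x0 (a b c : ℝ) (x y z : Oct ℝ) : (h1 a b c x y z).2 0 = x := rfl
@[simp] theorem h1_x1 (a b c : ℝ) (x y z : Oct ℝ) : (h1 a b c x y z).2 1 = y := rfl
@[simp] theorem h1_x2 (a b c : ℝ) (x y z : Oct ℝ) : (h1 a b c x y z).2 2 = z := rfl

theorem h1_zero : h1 0 0 0 0 0 0 = 0 := J_ext rfl rfl rfl rfl rfl rfl

/-! ### Octonion identities: inner product, conjugation, alternativity. -/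

namespace Oct

theorem ip_comm {R : Type} [CommRing R] (x y : Oct R) : ip x y = ip y x := by
  simp only [ip, mul_comm]

theorem add_ip {R : Type} [CommRing R] (x y z : Oct R) : ip (x + y) z = ip x z + ip y z := by
  rw [ip_comm, ip_add, ip_comm z, ip_comm z]

theorem smul_ip {R : Type} [CommRing R] (r : R) (x y : Oct R) : ip (r • x) y = r * ip x y := by
  rw [ip_comm, ip_smul, ip_comm y]

theorem ip_eq {R : Type} [CommRing R] (x y : Oct R) : ip x y =
    x.c 0 * y.c 0 + x.c 1 * y.c 1 + x.c 2 * y.c 2 + x.c 3 * y.c 3 + x.c 4 * y.c 4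
      + x.c 5 * y.c 5 + x.c 6 * y.c 6 + x.c 7 * y.c 7 := by
  simp only [ip, Fin.sum_univ_eight]

theorem ip_self_nonneg (x : Oct ℝ) : 0 ≤ ip x x := by
  rw [ip]; exact Finset.sum_nonneg fun i _ => mul_self_nonneg _

theorem ip_self_eq_zero {x : Oct ℝ} (h : ip x x = 0) : x = 0 := by
  have hs : ∑ i, x.c i * x.c i = 0 := by simpa only [ip] using h
  refine Oct.ext (funext fun i => ?_)
  have := (Finset.sum_eq_zero_iff_of_nonneg fun j _ => mul_self_nonneg (x.c j)).1 hs i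
    (Finset.mem_univ i)
  simpa using this

@[simp] theorem ip_zero {R : Type} [CommRing R] (x : Oct R) : ip x 0 = 0 := by simp [ip]

@[simp] theorem zero_ip {R : Type} [CommRing R] (x : Oct R) : ip 0 x = 0 := by simp [ip]

@[simp] theorem conj_zero {R : Type} [CommRing R] : conj (0 : Oct R) = 0 := by
  apply ext8 <;> simp [conj_c]

@[simp] theorem conj_one {R : Type} [CommRing R] : conj (1 : Oct R) = 1 := by
  apply ext8 <;> simp [conj_c]

theorem one_ip {R : Type} [CommRing R] (x : Oct R) : ip 1 x = x.c 0 := by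
  simp [ip_eq]

theorem ip_conj_conj {R : Type} [CommRing R] (x y : Oct R) : ip (conj x) (conj y) = ip x y := by
  simp only [ip_eq, conj_c, Matrix.cons_val]; ring

/-- A form of the alternative law; it replaces associativity in the orbit computations below. -/
theorem conj_mul_cancel (b y : Oct ℝ) : conj b * (b * y) = ip b b • y := by
  apply ext8 <;> simp only [ip_eq, conj_c, mul_c, smul_c, Pi.smul_apply, smul_eq_mul,
    Matrix.cons_val] <;> ring

theorem mul_conj_cancel (b y : Oct ℝ) : b * (conj b * y) = ip b b • y := by
  have := conj_mul_cancel (conj b) y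
  rwa [conj_conj, ip_conj_conj] at this

end Oct

/-! ### The Jordan product as a bilinear map -/

theorem jmul_comm (X Y : J) : jmul X Y = jmul Y X := by
  apply J_ext <;> simp only [jmul, h1_xi0, h1_xi1, h1_xi2, h1_x0, h1_x1, h1_x2]
  · rw [Oct.ip_comm (X.2 1), Oct.ip_comm (X.2 2)]; ring
  · rw [Oct.ip_comm (X.2 0), Oct.ip_comm (X.2 2)]; ring
  · rw [Oct.ip_comm (X.2 0), Oct.ip_comm (X.2 1)]; ring
  · rw [add_comm (X.2 1 * _)]; module
  · rw [add_comm (X.2 2 * _)]; module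
  · rw [add_comm (X.2 0 * _)]; module

theorem jmul_add (X Y Z : J) : jmul X (Y + Z) = jmul X Y + jmul X Z := by
  simp only [jmul, h1_add]
  congr 1 <;> simp only [Prod.fst_add, Prod.snd_add, Pi.add_apply, Oct.ip_add, Oct.conj_add,
      add_mul, mul_add]
  all_goals module

theorem jmul_smul (r : ℝ) (X Y : J) : jmul X (r • Y) = r • jmul X Y := by
  simp only [jmul, smul_h1]
  congr 1 <;> simp only [Prod.smul_fst, Prod.smul_snd, Pi.smul_apply, Oct.ip_smul, Oct.conj_add,
      Oct.conj_smul, smul_mul_assoc, mul_smul_comm, smul_eq_mul]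
  · ring
  · ring
  · ring
  all_goals module

/-- The Jordan multiplication as a continuous bilinear map. -/
def jmulL : J →L[ℝ] J →L[ℝ] J :=
  LinearMap.toContinuousLinearMap
    ((LinearMap.toContinuousLinearMap (𝕜 := ℝ) (E := J) (F' := J)).toLinearMap ∘ₗ
      LinearMap.mk₂ ℝ jmul
        (fun X Y Z => by rw [jmul_comm, jmul_add, jmul_comm Z, jmul_comm Z])
        (fun r X Y => by rw [jmul_comm, jmul_smul, jmul_comm Y])
        (fun X Y Z => jmul_add X Y Z) (fun r X Y => jmul_smul r X Y))

@[simp] theorem jmulL_apply (X Y : J) : jmulL X Y = jmul X Y := rfl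

theorem add_jmul (X Y Z : J) : jmul (X + Y) Z = jmul X Z + jmul Y Z := by
  simp only [← jmulL_apply, map_add, add_apply]

theorem smul_jmul (r : ℝ) (X Y : J) : jmul (r • X) Y = r • jmul X Y := by
  simp only [← jmulL_apply, map_smul, smul_apply]

theorem jmul_sub (X Y Z : J) : jmul X (Y - Z) = jmul X Y - jmul X Z := map_sub (jmulL X) Y Z

theorem sub_jmul (X Y Z : J) : jmul (X - Y) Z = jmul X Z - jmul Y Z := by
  simp only [← jmulL_apply, map_sub, sub_apply]

@[simp] theorem jmul_zero (X : J) : jmul X 0 = 0 := map_zero (jmulL X)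

/-! ### Exponentials -/

@[simp] theorem expU_val (D : EndJ) : ((expU D : EndJˣ) : EndJ) = NormedSpace.exp D := rfl

theorem EndJ_mul_apply (A B : EndJ) (X : J) : (A * B) X = A (B X) := rfl

theorem units_mul_apply (g h : EndJˣ) (X : J) :
    ((g * h : EndJˣ) : EndJ) X = (g : EndJ) ((h : EndJ) X) := rfl

theorem units_apply_inv (g : EndJˣ) (X : J) : (g : EndJ) (((g⁻¹ : EndJˣ) : EndJ) X) = X := by
  rw [← units_mul_apply, mul_inv_cancel]; rfl

theorem units_inv_apply (g : EndJˣ) (X : J) : ((g⁻¹ : EndJˣ) : EndJ) ((g : EndJ) X) = X := by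
  rw [← units_mul_apply, inv_mul_cancel]; rfl

theorem exp_neg_apply (D : EndJ) (X : J) :
    (NormedSpace.exp D : EndJ) ((NormedSpace.exp (-D) : EndJ) X) = X := units_apply_inv (expU D) X

theorem hasDerivAt_exp_apply (D : EndJ) (X : J) (t : ℝ) :
    HasDerivAt (fun u : ℝ => NormedSpace.exp (u • D) X) (D (NormedSpace.exp (t • D) X)) t := by
  have h := hasDerivAt_exp_smul_const' (𝕂 := ℝ) D t
  exact h.clm_apply (hasDerivAt_const t X) |>.congr_deriv (by simp)

/-- Solutions of the linear equation `γ' = D γ` are given by the exponential. -/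
theorem exp_apply_of_hasDerivAt {D : EndJ} {γ : ℝ → J} (h : ∀ t, HasDerivAt γ (D (γ t)) t)
    (t : ℝ) : NormedSpace.exp (t • D) (γ 0) = γ t := by
  -- The curve `exp (-u D) (γ u)` is constant, because the two terms of its derivative cancel.
  have hd : ∀ s : ℝ, HasDerivAt (fun u : ℝ => NormedSpace.exp (u • (-D)) (γ u)) 0 s := by
    intro s
    have h1 := (hasDerivAt_exp_smul_const (𝕂 := ℝ) (-D) s).clm_apply (h s)
    refine h1.congr_deriv ?_
    have e : (NormedSpace.exp (s • -D) * -D) (γ s) = -(NormedSpace.exp (s • -D) : EndJ) (D (γ s)) :=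
      map_neg (NormedSpace.exp (s • -D) : EndJ) (D (γ s))
    rw [e, neg_add_cancel]
  have hc := is_const_of_deriv_eq_zero (fun s => (hd s).differentiableAt)
    (fun s => (hd s).deriv) t 0
  simp only [zero_smul, smul_neg, neg_zero, NormedSpace.exp_zero] at hc
  have := congrArg (NormedSpace.exp (t • D) : EndJ) hc
  rw [exp_neg_apply] at this
  exact this.symm

theorem exp_apply_eq {D : EndJ} {γ : ℝ → J} (h : ∀ t, HasDerivAt γ (D (γ t)) t) {X : J}
    (h0 : γ 0 = X) (t : ℝ) : NormedSpace.exp (t • D) X = γ t :=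
  h0 ▸ exp_apply_of_hasDerivAt h t

theorem exp_apply_eq_self {D : EndJ} {X : J} (h : D X = 0) (t : ℝ) :
    NormedSpace.exp (t • D) X = X :=
  exp_apply_eq (γ := fun _ => X) (fun s => by rw [h]; exact hasDerivAt_const s X) rfl t

theorem exp_apply_eigen {D : EndJ} {X : J} {c : ℝ} (h : D X = c • X) (t : ℝ) :
    NormedSpace.exp (t • D) X = Real.exp (t * c) • X := by
  refine exp_apply_eq (γ := fun t => Real.exp (t * c) • X) (fun s => ?_) (by simp) t
  have h1 : HasDerivAt (fun u : ℝ => Real.exp (u * c)) (Real.exp (s * c) * c) s := by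
    simpa using ((hasDerivAt_id s).mul_const c).exp
  refine (h1.smul_const X).congr_deriv ?_
  rw [map_smul, h, smul_smul]

/-- If `L D² = 0`, then `L exp D = L + L D`. -/
theorem comp_exp_apply {V : Type*} [NormedAddCommGroup V] [NormedSpace ℝ V] (L : J →L[ℝ] V)
    {D : EndJ} (h : ∀ X, L (D (D X)) = 0) (X : J) :
    L (NormedSpace.exp D X) = L X + L (D X) := by
  -- Along the flow, `L D` has derivative `L D² = 0`. So the derivative of `L` is constant and `L`
  -- is affine in the time.
  have e : ∀ t : ℝ, HasDerivAt (fun u : ℝ => L (D (NormedSpace.exp (u • D) X))) 0 t := fun t => by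
    have := (L.comp D).hasFDerivAt.comp_hasDerivAt t (hasDerivAt_exp_apply D X t)
    exact this.congr_deriv (h _)
  have ec : ∀ t : ℝ, L (D (NormedSpace.exp (t • D) X)) = L (D X) := fun t => by
    have := is_const_of_deriv_eq_zero (fun s => (e s).differentiableAt) (fun s => (e s).deriv) t 0
    simpa using this
  have e' : ∀ t : ℝ,
      HasDerivAt (fun u : ℝ => L (NormedSpace.exp (u • D) X) - u • L (D X)) 0 t := fun t => by
    have h1 := L.hasFDerivAt.comp_hasDerivAt t (hasDerivAt_exp_apply D X t)
    refine (h1.sub ((hasDerivAt_id t).smul_const (L (D X)))).congr_deriv ?_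
    rw [ec, one_smul, sub_self]
  have := is_const_of_deriv_eq_zero (fun s => (e' s).differentiableAt) (fun s => (e' s).deriv) 1 0
  simp only [one_smul, zero_smul, NormedSpace.exp_zero, sub_zero] at this
  rw [sub_eq_iff_eq_add.1 this]
  rfl

/-! ### Derivations -/

/-- Derivations of the Jordan algebra. -/
def IsDer (D : EndJ) : Prop := ∀ X Y : J, D (jmul X Y) = jmul (D X) Y + jmul X (D Y)

theorem hasDerivAt_jmul {γ δ : ℝ → J} {γ' δ' : J} {t : ℝ} (h : HasDerivAt γ γ' t)
    (k : HasDerivAt δ δ' t) :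
    HasDerivAt (fun u => jmul (γ u) (δ u)) (jmul γ' (δ t) + jmul (γ t) δ') t :=
  (jmulL.hasFDerivAt.comp_hasDerivAt t h).clm_apply k

/-- One direction differentiates the automorphism identity at `t = 0`. In the other, the product of
two flow lines solves `γ' = D γ`, and solutions are unique. -/
theorem mem_f4_iff {D : EndJ} : D ∈ f4 ↔ IsDer D := by
  constructor
  · intro h X Y
    have h1 := hasDerivAt_exp_apply D (jmul X Y) 0
    have h2 := hasDerivAt_jmul (hasDerivAt_exp_apply D X 0) (hasDerivAt_exp_apply D Y 0)
    have : (fun u : ℝ => NormedSpace.exp (u • D) (jmul X Y)) =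
        fun u : ℝ => jmul (NormedSpace.exp (u • D) X) (NormedSpace.exp (u • D) Y) :=
      funext fun u => h u X Y
    rw [this] at h1
    simpa using h1.unique h2
  · intro h t X Y
    refine exp_apply_eq (D := D)
      (γ := fun t => jmul (NormedSpace.exp (t • D) X) (NormedSpace.exp (t • D) Y))
      (fun s => ?_) (by simp) t
    rw [h]
    exact hasDerivAt_jmul (hasDerivAt_exp_apply D X s) (hasDerivAt_exp_apply D Y s)

theorem expU_mem_F4 {D : EndJ} (h : D ∈ f4) : expU D ∈ F4 := by
  simpa using h 1

namespace IsDer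

variable {D E : EndJ}

theorem add (hD : IsDer D) (hE : IsDer E) : IsDer (D + E) := fun X Y => by
  simp only [add_apply, hD X Y, hE X Y, jmul_add, add_jmul]; abel

theorem smul (hD : IsDer D) (r : ℝ) : IsDer (r • D) := fun X Y => by
  simp only [smul_apply, hD X Y, jmul_smul, smul_jmul, smul_add]

theorem brk (hD : IsDer D) (hE : IsDer E) : IsDer (F4m20.brk D E) := fun X Y => by
  simp only [F4m20.brk, sub_apply, EndJ_mul_apply, hD X Y, hE X Y, map_add, hD _ _, hE _ _,
    jmul_sub, sub_jmul]
  abel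

end IsDer

theorem jmul_self_der {D : EndJ} (hD : IsDer D) {X Y : J} (h : jmul X X = Y) :
    D Y = (2 : ℝ) • jmul X (D X) := by
  rw [← h, hD, jmul_comm, two_smul]

theorem jmul_polarize {X Y : J} :
    jmul X Y = (1 / 2 : ℝ) • (jmul (X + Y) (X + Y) - jmul X X - jmul Y Y) := by
  rw [jmul_add, add_jmul, add_jmul, jmul_comm Y X]
  module

/-- A linear map is a derivation if it acts on squares as one. -/
theorem isDer_of_sq {D : EndJ} (h : ∀ X, D (jmul X X) = (2 : ℝ) • jmul X (D X)) : IsDer D := by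
  intro X Y
  rw [jmul_polarize (X := X) (Y := Y), map_smul, map_sub, map_sub, h, h, h, map_add,
    jmul_add, add_jmul, add_jmul, jmul_comm Y (D X)]
  module

set_option maxHeartbeats 2000000 in
theorem A1_isDer (a : Oct ℝ) : IsDer (A1 a) := by
  refine isDer_of_sq fun X => ?_
  change A1Lin a (jmul X X) = (2 : ℝ) • jmul X (A1Lin a X)
  simp only [A1Lin, LinearMap.coe_mk, AddHom.coe_mk]
  simp only [jmul, smul_h1, h1_xi0, h1_xi1, h1_xi2, h1_x0, h1_x1, h1_x2]
  congr 1
  · simp only [Oct.ip_eq, Oct.conj_c, Oct.mul_c, Oct.add_c, Oct.sub_c, Oct.neg_c, Oct.smul_c,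
      Pi.add_apply, Pi.sub_apply, Pi.neg_apply, Pi.smul_apply, smul_eq_mul, Matrix.cons_val]
    ring
  · simp only [Oct.ip_eq, Oct.conj_c, Oct.mul_c, Oct.add_c, Oct.sub_c, Oct.neg_c, Oct.smul_c,
      Pi.add_apply, Pi.sub_apply, Pi.neg_apply, Pi.smul_apply, smul_eq_mul, Matrix.cons_val]
    ring
  · simp only [Oct.ip_eq, Oct.conj_c, Oct.mul_c, Oct.add_c, Oct.sub_c, Oct.neg_c, Oct.smul_c,
      Pi.add_apply, Pi.sub_apply, Pi.neg_apply, Pi.smul_apply, smul_eq_mul, Matrix.cons_val]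
    ring
  all_goals
    apply Oct.ext8 <;>
    simp only [Oct.ip_eq, Oct.conj_c, Oct.mul_c, Oct.add_c, Oct.sub_c, Oct.neg_c, Oct.smul_c,
      Pi.add_apply, Pi.sub_apply, Pi.neg_apply, Pi.smul_apply, smul_eq_mul, Matrix.cons_val] <;>
    ring

set_option maxHeartbeats 2000000 in
theorem A3_isDer (a : Oct ℝ) : IsDer (A3 a) := by
  refine isDer_of_sq fun X => ?_
  change A3Lin a (jmul X X) = (2 : ℝ) • jmul X (A3Lin a X)
  simp only [A3Lin, LinearMap.coe_mk, AddHom.coe_mk]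
  simp only [jmul, smul_h1, h1_xi0, h1_xi1, h1_xi2, h1_x0, h1_x1, h1_x2]
  congr 1
  · simp only [Oct.ip_eq, Oct.conj_c, Oct.mul_c, Oct.add_c, Oct.sub_c, Oct.neg_c, Oct.smul_c,
      Pi.add_apply, Pi.sub_apply, Pi.neg_apply, Pi.smul_apply, smul_eq_mul, Matrix.cons_val]
    ring
  · simp only [Oct.ip_eq, Oct.conj_c, Oct.mul_c, Oct.add_c, Oct.sub_c, Oct.neg_c, Oct.smul_c,
      Pi.add_apply, Pi.sub_apply, Pi.neg_apply, Pi.smul_apply, smul_eq_mul, Matrix.cons_val]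
    ring
  · simp only [Oct.ip_eq, Oct.conj_c, Oct.mul_c, Oct.add_c, Oct.sub_c, Oct.neg_c, Oct.smul_c,
      Pi.add_apply, Pi.sub_apply, Pi.neg_apply, Pi.smul_apply, smul_eq_mul, Matrix.cons_val]
    ring
  all_goals
    apply Oct.ext8 <;>
    simp only [Oct.ip_eq, Oct.conj_c, Oct.mul_c, Oct.add_c, Oct.sub_c, Oct.neg_c, Oct.smul_c,
      Pi.add_apply, Pi.sub_apply, Pi.neg_apply, Pi.smul_apply, smul_eq_mul, Matrix.cons_val] <;>
    ring

/-! ### Elements of the root spaces -/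

theorem A1_apply (a : Oct ℝ) (X : J) : A1 a X = h1 0 (2 * a.ip (X.2 0)) (-2 * a.ip (X.2 0))
    ((X.1 2 - X.1 1) • a) (-(X.2 2 * a).conj) (a * X.2 1).conj := rfl

theorem A3_apply (a : Oct ℝ) (X : J) : A3 a X = h1 (-2 * a.ip (X.2 2)) (2 * a.ip (X.2 2)) 0
    (X.2 1 * a).conj (a * X.2 0).conj ((X.1 1 - X.1 0) • a) := rfl

theorem A3_one_apply (X : J) : A3 1 X = h1 (-2 * (X.2 2).c 0) (2 * (X.2 2).c 0) 0
    (X.2 1).conj (X.2 0).conj ((X.1 1 - X.1 0) • 1) := by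
  rw [A3_apply, Oct.one_ip, one_mul, mul_one]

theorem brk_apply (D E : EndJ) (X : J) : brk D E X = D (E X) - E (D X) := rfl

theorem h1_sub (a b c a' b' c' : ℝ) (x y z x' y' z' : Oct ℝ) :
    h1 a b c x y z - h1 a' b' c' x' y' z' =
      h1 (a - a') (b - b') (c - c') (x - x') (y - y') (z - z') := by
  refine J_ext rfl rfl rfl rfl rfl rfl

theorem neg_h1 (a b c : ℝ) (x y z : Oct ℝ) :
    -h1 a b c x y z = h1 (-a) (-b) (-c) (-x) (-y) (-z) :=
  J_ext rfl rfl rfl rfl rfl rfl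

/-- The element `Ã₂¹(b)` of the Lie algebra (up to sign). -/
def A2 (b : Oct ℝ) : EndJ := brk (A3 1) (A1 b.conj)

theorem A2_apply (b : Oct ℝ) (X : J) : A2 b X = h1 (-2 * b.ip (X.2 1)) 0 (2 * b.ip (X.2 1))
    (b * X.2 2).conj ((X.1 2 - X.1 0) • b) (X.2 0 * b).conj := by
  rw [A2, brk_apply, A3_one_apply, A3_one_apply, A1_apply, A1_apply, h1_sub]
  simp only [h1_xi0, h1_xi1, h1_xi2, h1_x0, h1_x1, h1_x2]
  congr 1
  · simp only [Oct.ip_eq, Oct.conj_c, Oct.mul_c, Matrix.cons_val]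
    ring
  · simp only [Oct.ip_eq, Oct.conj_c, Oct.mul_c, Matrix.cons_val]
    ring
  · simp only [Oct.ip_eq, Oct.conj_c, Oct.mul_c, Matrix.cons_val]
    ring
  all_goals
    apply Oct.ext8 <;>
    simp only [Oct.ip_eq, Oct.conj_c, Oct.mul_c, Oct.add_c, Oct.sub_c, Oct.neg_c, Oct.smul_c,
      Oct.one_c, Pi.add_apply, Pi.sub_apply, Pi.neg_apply, Pi.smul_apply, smul_eq_mul,
      Matrix.cons_val] <;>
    ring

theorem A2_isDer (b : Oct ℝ) : IsDer (A2 b) := (A3_isDer 1).brk (A1_isDer _)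

/-- `ad Ã₃¹(1)` interchanges `A1 a` and `A2 a.conj`, so their sum and difference are root vectors
for `α` and `-α`. -/
theorem brk_A3_one_A1 (a : Oct ℝ) : brk (A3 1) (A1 a) = A2 a.conj := by
  rw [A2, Oct.conj_conj]

theorem brk_A3_one_A2 (b : Oct ℝ) : brk (A3 1) (A2 b) = A1 b.conj := by
  refine ContinuousLinearMap.ext fun X => ?_
  rw [brk_apply, A3_one_apply, A3_one_apply, A1_apply, A2_apply, A2_apply, h1_sub]
  simp only [h1_xi0, h1_xi1, h1_xi2, h1_x0, h1_x1, h1_x2]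
  congr 1
  · simp only [Oct.ip_eq, Oct.conj_c, Oct.mul_c, Matrix.cons_val]
    ring
  · simp only [Oct.ip_eq, Oct.conj_c, Oct.mul_c, Matrix.cons_val]
    ring
  · simp only [Oct.ip_eq, Oct.conj_c, Oct.mul_c, Matrix.cons_val]
    ring
  all_goals
    apply Oct.ext8 <;>
    simp only [Oct.ip_eq, Oct.conj_c, Oct.mul_c, Oct.add_c, Oct.sub_c, Oct.neg_c, Oct.smul_c,
      Oct.one_c, Pi.add_apply, Pi.sub_apply, Pi.neg_apply, Pi.smul_apply, smul_eq_mul,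
      Matrix.cons_val] <;>
    ring

/-- The element of the Lie algebra that, for imaginary `p`, acts on the octonion coordinates by
`p x₁`, `x₂ p` and `-(p x₃ + x₃ p)`. -/
def rot (p : Oct ℝ) : EndJ := (1 / 2 : ℝ) • brk (A3 1) (A3 p)

theorem rot_apply {p : Oct ℝ} (hp : p.c 0 = 0) (X : J) : rot p X = h1 0 0 0 (p * X.2 0) (X.2 1 * p)
    ((2 * p.ip (X.2 2)) • 1 - (2 * (X.2 2).c 0) • p) := by
  rw [rot, smul_apply, brk_apply, A3_one_apply, A3_one_apply, A3_apply, A3_apply, h1_sub, smul_h1]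
  simp only [h1_xi0, h1_xi1, h1_xi2, h1_x0, h1_x1, h1_x2]
  congr 1
  · simp only [Oct.ip_eq, Oct.smul_c, Oct.one_c, Pi.smul_apply, smul_eq_mul, Matrix.cons_val, hp]
    ring
  · simp only [Oct.ip_eq, Oct.smul_c, Oct.one_c, Pi.smul_apply, smul_eq_mul, Matrix.cons_val, hp]
    ring
  · simp
  all_goals
    apply Oct.ext8 <;>
    simp only [Oct.ip_eq, Oct.conj_c, Oct.mul_c, Oct.add_c, Oct.sub_c, Oct.neg_c, Oct.smul_c,
      Oct.one_c, Pi.add_apply, Pi.sub_apply, Pi.neg_apply, Pi.smul_apply, smul_eq_mul,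
      Matrix.cons_val, hp] <;>
    ring

theorem rot_isDer (p : Oct ℝ) : IsDer (rot p) := ((A3_isDer 1).brk (A3_isDer _)).smul _

/-- The analogue for the long roots: for imaginary `p`, `ad Ã₃¹(1)` interchanges `A3 p` and `rot p`
up to the factor `2`, which gives root vectors for `±2α`. -/
theorem brk_A3_one_A3 (p : Oct ℝ) : brk (A3 1) (A3 p) = (2 : ℝ) • rot p := by
  rw [rot, smul_smul]; norm_num

theorem brk_A3_one_rot {p : Oct ℝ} (hp : p.c 0 = 0) : brk (A3 1) (rot p) = (2 : ℝ) • A3 p := by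
  refine ContinuousLinearMap.ext fun X => ?_
  rw [smul_apply, brk_apply, A3_one_apply, A3_one_apply, A3_apply, rot_apply hp, rot_apply hp,
    h1_sub, smul_h1]
  simp only [h1_xi0, h1_xi1, h1_xi2, h1_x0, h1_x1, h1_x2]
  congr 1
  · simp only [Oct.ip_eq, Oct.sub_c, Oct.smul_c, Oct.one_c, Pi.sub_apply, Pi.smul_apply,
      smul_eq_mul, Matrix.cons_val, hp]
    ring
  · simp only [Oct.ip_eq, Oct.sub_c, Oct.smul_c, Oct.one_c, Pi.sub_apply, Pi.smul_apply,
      smul_eq_mul, Matrix.cons_val, hp]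
    ring
  · ring
  all_goals
    apply Oct.ext8 <;>
    simp only [Oct.ip_eq, Oct.conj_c, Oct.mul_c, Oct.add_c, Oct.sub_c, Oct.neg_c, Oct.smul_c,
      Oct.one_c, Pi.add_apply, Pi.sub_apply, Pi.neg_apply, Pi.smul_apply, smul_eq_mul,
      Matrix.cons_val, hp] <;>
    ring

theorem brk_add (D E E' : EndJ) : brk D (E + E') = brk D E + brk D E' := by
  simp only [brk]; noncomm_ring

theorem brk_sub (D E E' : EndJ) : brk D (E - E') = brk D E - brk D E' := by
  simp only [brk, mul_sub, sub_mul]; abel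

theorem brk_smul (r : ℝ) (D E : EndJ) : brk D (r • E) = r • brk D E := by
  simp only [brk, mul_smul_comm, smul_mul_assoc, smul_sub]

theorem smul_brk (r : ℝ) (D E : EndJ) : brk (r • D) E = r • brk D E := by
  simp only [brk, mul_smul_comm, smul_mul_assoc, smul_sub]

theorem mem_rootSpace_iff {c : ℝ} {D : EndJ} :
    D ∈ rootSpace c ↔ IsDer D ∧ brk (A3 1) D = c • D := by
  rw [← mem_f4_iff]
  refine and_congr_right fun _ => ⟨fun h => by simpa using h 1, fun h t => ?_⟩
  rw [smul_brk, h, smul_smul, mul_comm]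

theorem A1_add_A2_mem (a : Oct ℝ) : A1 a + A2 a.conj ∈ rootSpace 1 := by
  refine mem_rootSpace_iff.2 ⟨(A1_isDer _).add (A2_isDer _), ?_⟩
  rw [brk_add, brk_A3_one_A1, brk_A3_one_A2, Oct.conj_conj, one_smul, add_comm]

theorem A2_sub_A1_mem (a : Oct ℝ) : A2 a.conj - A1 a ∈ rootSpace (-1) := by
  refine mem_rootSpace_iff.2 ⟨?_, ?_⟩
  · rw [sub_eq_add_neg, ← neg_one_smul ℝ]; exact (A2_isDer _).add ((A1_isDer _).smul _)
  rw [brk_sub, brk_A3_one_A1, brk_A3_one_A2, Oct.conj_conj]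
  module

theorem rot_add_A3_mem {p : Oct ℝ} (hp : p.c 0 = 0) : rot p + A3 p ∈ rootSpace 2 := by
  refine mem_rootSpace_iff.2 ⟨(rot_isDer _).add (A3_isDer _), ?_⟩
  rw [brk_add, brk_A3_one_rot hp, brk_A3_one_A3, smul_add, add_comm]

theorem rot_sub_A3_mem {p : Oct ℝ} (hp : p.c 0 = 0) : rot p - A3 p ∈ rootSpace (-2) := by
  refine mem_rootSpace_iff.2 ⟨?_, ?_⟩
  · rw [sub_eq_add_neg, ← neg_one_smul ℝ]; exact (rot_isDer _).add ((A3_isDer _).smul _)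
  rw [brk_sub, brk_A3_one_rot hp, brk_A3_one_A3]
  module

theorem rootSpace_smul {c : ℝ} {D : EndJ} (h : D ∈ rootSpace c) (r : ℝ) :
    r • D ∈ rootSpace c := by
  rw [mem_rootSpace_iff] at h ⊢
  exact ⟨h.1.smul r, by rw [brk_smul, h.2, smul_comm]⟩

theorem zero_mem_rootSpace (c : ℝ) : (0 : EndJ) ∈ rootSpace c := by
  have := rootSpace_smul (A1_add_A2_mem 0) 0
  rw [mem_rootSpace_iff] at this ⊢
  rw [zero_smul] at this
  exact ⟨this.1, by simp [brk]⟩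

/-! ### The Cartan involution -/

theorem sigma_apply (X : J) : (sigma : EndJ) X =
    h1 (X.1 0) (X.1 1) (X.1 2) (X.2 0) (-X.2 1) (-X.2 2) := rfl

theorem sigma_inv : sigma⁻¹ = sigma := Units.ext rfl

theorem sigma_sigma (X : J) : (sigma : EndJ) ((sigma : EndJ) X) = X := sigmaLin_sigmaLin X

theorem theta_apply (D : EndJ) (X : J) :
    theta D X = (sigma : EndJ) (D ((sigma : EndJ) X)) := by
  rw [theta, sigma_inv]; rfl

theorem theta_theta (D : EndJ) : theta (theta D) = D :=
  ContinuousLinearMap.ext fun X => by simp only [theta_apply, sigma_sigma]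

theorem theta_add (D E : EndJ) : theta (D + E) = theta D + theta E := by
  simp only [theta, mul_add, add_mul]

theorem theta_sub (D E : EndJ) : theta (D - E) = theta D - theta E := by
  simp only [theta, mul_sub, sub_mul]

theorem theta_smul (r : ℝ) (D : EndJ) : theta (r • D) = r • theta D := by
  simp only [theta, mul_smul_comm, smul_mul_assoc]

theorem theta_brk (D E : EndJ) : theta (brk D E) = brk (theta D) (theta E) :=
  ContinuousLinearMap.ext fun X => by
    simp only [theta_apply, brk_apply, map_sub, sigma_sigma]

theorem theta_zero : theta 0 = 0 := by
  simp [theta]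

theorem theta_A1 (a : Oct ℝ) : theta (A1 a) = A1 a :=
  ContinuousLinearMap.ext fun X => by
    rw [theta_apply, sigma_apply, sigma_apply, A1_apply, A1_apply]
    simp only [h1_xi0, h1_xi1, h1_xi2, h1_x0, h1_x1, h1_x2, neg_mul, mul_neg, Oct.conj_neg,
      neg_neg]

theorem theta_A3 (a : Oct ℝ) : theta (A3 a) = -A3 a :=
  ContinuousLinearMap.ext fun X => by
    rw [theta_apply, sigma_apply, sigma_apply, neg_apply, A3_apply, A3_apply, neg_h1]
    simp only [h1_xi0, h1_xi1, h1_xi2, h1_x0, h1_x1, h1_x2, neg_mul, mul_neg, Oct.conj_neg,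
      neg_neg, ← neg_one_smul ℝ (X.2 2), Oct.ip_smul, neg_zero, one_mul]

theorem theta_A2 (b : Oct ℝ) : theta (A2 b) = -A2 b := by
  rw [A2, theta_brk, theta_A1, theta_A3, ← neg_one_smul ℝ (A3 1), smul_brk]
  module

theorem theta_rot (p : Oct ℝ) : theta (rot p) = rot p := by
  rw [rot, theta_smul, theta_brk, theta_A3, theta_A3, ← neg_one_smul ℝ (A3 1),
    ← neg_one_smul ℝ (A3 p), smul_brk, brk_smul, smul_smul (-1 : ℝ), neg_mul_neg, one_mul,
    one_smul]

/-! ### Elements of `𝔨_ε` -/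

theorem zero_mem_lieA : (0 : EndJ) ∈ lieA := ⟨0, by simp⟩

theorem zero_mem_lieM : (0 : EndJ) ∈ lieM :=
  ⟨(zero_mem_rootSpace 1).1, theta_zero, by simp [brk]⟩

/-- `A2 b` is `θ`-odd and lies in `𝔤_α + 𝔤_{-α}`, where `θ_ε = -θ`. The witnesses are its two root
components. -/
theorem A2_mem_lieKeps (b : Oct ℝ) : A2 b ∈ lieKeps := by
  refine ⟨0, zero_mem_lieA, 0, zero_mem_lieM, (1 / 2 : ℝ) • (A1 b.conj + A2 b),
    rootSpace_smul ?_ _, 0, zero_mem_rootSpace _, (1 / 2 : ℝ) • (A2 b - A1 b.conj),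
    rootSpace_smul ?_ _, 0, zero_mem_rootSpace _, ?_, ?_⟩
  · simpa only [Oct.conj_conj] using A1_add_A2_mem b.conj
  · simpa only [Oct.conj_conj] using A2_sub_A1_mem b.conj
  · module
  · simp only [theta_zero, theta_smul, theta_add, theta_sub, theta_A1, theta_A2]
    module

/-- `rot p` is `θ`-even and lies in `𝔤_{2α} + 𝔤_{-2α}`, where `θ_ε = θ`. -/
theorem rot_mem_lieKeps {p : Oct ℝ} (hp : p.c 0 = 0) : rot p ∈ lieKeps := by
  refine ⟨0, zero_mem_lieA, 0, zero_mem_lieM, 0, zero_mem_rootSpace _,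
    (1 / 2 : ℝ) • (rot p + A3 p), rootSpace_smul (rot_add_A3_mem hp) _, 0, zero_mem_rootSpace _,
    (1 / 2 : ℝ) • (rot p - A3 p), rootSpace_smul (rot_sub_A3_mem hp) _, ?_, ?_⟩
  · module
  · simp only [theta_zero, theta_smul, theta_add, theta_sub, theta_A3, theta_rot]
    module

theorem smul_mem_lieKeps {D : EndJ} (h : D ∈ lieKeps) (r : ℝ) : r • D ∈ lieKeps := by
  obtain ⟨H, ⟨s, rfl⟩, D, hD, U₁, hU₁, U₂, hU₂, V₁, hV₁, V₂, hV₂, e, e'⟩ := h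
  refine ⟨r • s • A3 1, ⟨r * s, by rw [smul_smul]⟩, r • D,
    ⟨mem_f4_iff.2 ((mem_f4_iff.1 hD.1).smul r), by rw [theta_smul, hD.2.1],
      by rw [smul_brk, hD.2.2, smul_zero]⟩,
    r • U₁, rootSpace_smul hU₁ r, r • U₂, rootSpace_smul hU₂ r, r • V₁, rootSpace_smul hV₁ r,
    r • V₂, rootSpace_smul hV₂ r, ?_, ?_⟩
  · rw [e]; module
  · rw [e']; simp only [theta_smul]; module

/-! ### Idempotents and Peirce components -/

/-- The element `E₁`. -/
def E1 : J := h1 1 0 0 0 0 0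

/-- The element `E₃`. -/
def E3 : J := h1 0 0 1 0 0 0

/-- The element `F₃(1)`. -/
def F3 : J := h1 0 0 0 0 0 1

theorem jmul_h1 (a b c a' b' c' : ℝ) (x y z x' y' z' : Oct ℝ) :
    jmul (h1 a b c x y z) (h1 a' b' c' x' y' z') =
      h1 (a * a' - y.ip y' - z.ip z') (b * b' + x.ip x' - z.ip z') (c * c' + x.ip x' - y.ip y')
        ((1 / 2 : ℝ) • ((b + c) • x' + (b' + c') • x - (y * z' + y' * z).conj))
        ((1 / 2 : ℝ) • ((c + a) • y' + (c' + a') • y + (z * x' + z' * x).conj))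
        ((1 / 2 : ℝ) • ((a + b) • z' + (a' + b') • z + (x * y' + x' * y).conj)) := rfl

theorem jmul_E1 (X : J) :
    jmul E1 X = h1 (X.1 0) 0 0 0 ((1 / 2 : ℝ) • X.2 1) ((1 / 2 : ℝ) • X.2 2) := by
  rw [← h1_eta X, E1, jmul_h1]; simp

theorem jmul_E2 (X : J) :
    jmul E2 X = h1 0 (X.1 1) 0 ((1 / 2 : ℝ) • X.2 0) 0 ((1 / 2 : ℝ) • X.2 2) := by
  rw [← h1_eta X, E2, jmul_h1]; simp

theorem jmul_E3 (X : J) :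
    jmul E3 X = h1 0 0 (X.1 2) ((1 / 2 : ℝ) • X.2 0) ((1 / 2 : ℝ) • X.2 1) 0 := by
  rw [← h1_eta X, E3, jmul_h1]; simp

theorem E1_sq : jmul E1 E1 = E1 := by rw [jmul_E1]; simp [E1]

theorem E2_sq : jmul E2 E2 = E2 := by rw [jmul_E2]; simp [E2]

theorem E3_sq : jmul E3 E3 = E3 := by rw [jmul_E3]; simp [E3]

theorem F3_sq : jmul F3 F3 = -(E1 + E2) := by
  rw [F3, jmul_h1, E1, E2, h1_add, neg_h1]
  simp [Oct.one_ip]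

theorem jmul_one_left (X : J) : jmul (E1 + E2 + E3) X = X := by
  rw [add_jmul, add_jmul, jmul_E1, jmul_E2, jmul_E3, h1_add, h1_add]
  apply J_ext <;> simp only [h1_xi0, h1_xi1, h1_xi2, h1_x0, h1_x1, h1_x2] <;> module

theorem sub_eq_P : Pminus = E2 - E1 + F3 := by
  rw [Pminus, E2, E1, F3, h1_sub, h1_add]; simp

/-- Differentiating `e ∘ e = e` gives `D e = 2 e ∘ D e`, so `D e` lies in the Peirce `1/2`-space of
`e`. The same argument serves `E₂` and `E₃`. -/
theorem der_E1 {D : EndJ} (h : IsDer D) :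
    (D E1).1 0 = 0 ∧ (D E1).1 1 = 0 ∧ (D E1).1 2 = 0 ∧ (D E1).2 0 = 0 := by
  have e := jmul_self_der h E1_sq
  rw [jmul_E1, smul_h1] at e
  have e0 := congrArg (fun X : J => X.1 0) e
  simp only [h1_xi0] at e0
  refine ⟨by linarith, ?_, ?_, ?_⟩ <;> rw [e] <;> simp

theorem der_E2 {D : EndJ} (h : IsDer D) :
    (D E2).1 0 = 0 ∧ (D E2).1 1 = 0 ∧ (D E2).1 2 = 0 ∧ (D E2).2 1 = 0 := by
  have e := jmul_self_der h E2_sq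
  rw [jmul_E2, smul_h1] at e
  have e0 := congrArg (fun X : J => X.1 1) e
  simp only [h1_xi1] at e0
  refine ⟨?_, by linarith, ?_, ?_⟩ <;> rw [e] <;> simp

theorem der_E3 {D : EndJ} (h : IsDer D) :
    (D E3).1 0 = 0 ∧ (D E3).1 1 = 0 ∧ (D E3).1 2 = 0 ∧ (D E3).2 2 = 0 := by
  have e := jmul_self_der h E3_sq
  rw [jmul_E3, smul_h1] at e
  have e0 := congrArg (fun X : J => X.1 2) e
  simp only [h1_xi2] at e0
  refine ⟨?_, ?_, by linarith, ?_⟩ <;> rw [e] <;> simp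

theorem der_one {D : EndJ} (h : IsDer D) : D (E1 + E2 + E3) = 0 := by
  have e := jmul_self_der h (jmul_one_left (E1 + E2 + E3))
  rw [jmul_one_left, two_smul] at e
  exact left_eq_add.1 e

theorem sigma_E1 : (sigma : EndJ) E1 = E1 := by rw [sigma_apply]; simp [E1]

theorem sigma_E2 : (sigma : EndJ) E2 = E2 := by rw [sigma_apply]; simp [E2]

theorem oct_eq_zero_of_eq_neg {x : Oct ℝ} (h : x = -x) : x = 0 := by
  have e : (2 : ℝ) • x = 0 := by rw [two_smul]; nth_rewrite 1 [h]; exact neg_add_cancel x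
  exact (smul_eq_zero.1 e).resolve_left two_ne_zero

/-- Derivations that commute with `σ` kill `E₁`. -/
theorem der_E1_eq_zero {D : EndJ} (h : IsDer D) (hθ : theta D = D) : D E1 = 0 := by
  -- `D E₁` is `σ`-even, whereas the Peirce `1/2`-space of `E₁` is `σ`-odd.
  have e : (sigma : EndJ) (D E1) = D E1 := by
    conv_rhs => rw [← hθ, theta_apply, sigma_E1]
  obtain ⟨a, b, c, d⟩ := der_E1 h
  rw [sigma_apply] at e
  have e1 := congrArg (fun X : J => X.2 1) e
  have e2 := congrArg (fun X : J => X.2 2) e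
  simp only [h1_x1, h1_x2] at e1 e2
  exact J_ext a b c d (oct_eq_zero_of_eq_neg e1.symm) (oct_eq_zero_of_eq_neg e2.symm)

theorem A3_one_E1 : A3 1 E1 = -F3 := by
  rw [A3_one_apply, E1, F3, neg_h1]; simp

/-- `D` kills `E₁` and commutes with `Ã₃¹(1)`, hence kills `F3 = -Ã₃¹(1) E₁`, and then `E₁ + E₂ =
-F3 ∘ F3`. -/
theorem lieM_E2 {D : EndJ} (h : D ∈ lieM) : D E2 = 0 := by
  have hD := mem_f4_iff.1 h.1
  have h1 := der_E1_eq_zero hD h.2.1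
  have hF : D F3 = 0 := by
    have e : brk D (A3 1) E1 = 0 := by rw [h.2.2]; rfl
    rw [brk_apply, h1, map_zero, A3_one_E1, map_neg, sub_zero] at e
    exact neg_eq_zero.1 e
  have e := jmul_self_der hD F3_sq
  rw [hF, jmul_zero, smul_zero, map_neg, map_add, h1, zero_add] at e
  exact neg_eq_zero.1 e

/-! ### Weights of `Ã₃¹(1)` -/

/-- On the pair `(x₁, x₂)`, `Ã₃¹(1)` is the conjugate swap, whose square is the identity; only the
weights `±1` occur there. -/
theorem weight_x {c : ℝ} {Z : J} (h : A3 1 Z = c • Z) (hc : c ^ 2 ≠ 1) :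
    Z.2 0 = 0 ∧ Z.2 1 = 0 := by
  rw [A3_one_apply] at h
  have e0 : (Z.2 1).conj = c • Z.2 0 := congrArg (fun X : J => X.2 0) h
  have e1 : (Z.2 0).conj = c • Z.2 1 := congrArg (fun X : J => X.2 1) h
  have k : ∀ x y : Oct ℝ, x.conj = c • y → y.conj = c • x → x = 0 := fun x y hx hy => by
    have : x = (c ^ 2) • x := by
      conv_lhs => rw [← Oct.conj_conj x, hx, Oct.conj_smul, hy, smul_smul, ← pow_two]
    have h2 : (1 - c ^ 2) • x = 0 := by rw [sub_smul, one_smul, ← this, sub_self]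
    exact (smul_eq_zero.1 h2).resolve_left (sub_ne_zero.2 hc.symm)
  exact ⟨k _ _ e1 e0, k _ _ e0 e1⟩

/-- On the complementary coordinates `(ξ₁, ξ₂, ξ₃, x₃)` only the weights `0, ±2` occur. -/
theorem weight_xi {c : ℝ} {Z : J} (h : A3 1 Z = c • Z) (hc : c ≠ 0) (hc' : c ^ 2 ≠ 4) :
    Z.1 0 = 0 ∧ Z.1 1 = 0 ∧ Z.1 2 = 0 ∧ Z.2 2 = 0 := by
  rw [A3_one_apply] at h
  have e0 : -2 * (Z.2 2).c 0 = c * Z.1 0 := congrArg (fun X : J => X.1 0) h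
  have e1 : 2 * (Z.2 2).c 0 = c * Z.1 1 := congrArg (fun X : J => X.1 1) h
  have e2 : 0 = c * Z.1 2 := congrArg (fun X : J => X.1 2) h
  have e3 : (Z.1 1 - Z.1 0) • (1 : Oct ℝ) = c • Z.2 2 := congrArg (fun X : J => X.2 2) h
  have e4 : Z.1 1 - Z.1 0 = c * (Z.2 2).c 0 := by
    have := congrArg (fun x : Oct ℝ => x.c 0) e3
    simpa using this
  have r : (Z.2 2).c 0 = 0 := by
    have : (4 - c ^ 2) * (Z.2 2).c 0 = 0 := by linear_combination c * e4 + e1 - e0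
    exact (mul_eq_zero.1 this).resolve_left (sub_ne_zero.2 hc'.symm)
  rw [r] at e0 e1 e4
  have x2 : Z.2 2 = 0 := by
    rw [e4, mul_zero, zero_smul] at e3
    exact (smul_eq_zero.1 e3.symm).resolve_left hc
  refine ⟨?_, ?_, ?_, x2⟩
  · simpa [hc] using e0.symm
  · simpa [hc] using e1.symm
  · simpa [hc] using e2.symm

theorem rootSpace_weight {c d : ℝ} {D : EndJ} (h : D ∈ rootSpace c) {X : J}
    (hX : A3 1 X = d • X) : A3 1 (D X) = (c + d) • D X := by
  have e := congrArg (fun E : EndJ => E X) (mem_rootSpace_iff.1 h).2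
  simp only [brk_apply, hX, map_smul, smul_apply] at e
  rw [sub_eq_iff_eq_add.1 e, add_smul]

theorem A3_one_E3 : A3 1 E3 = (0 : ℝ) • E3 := by
  rw [A3_one_apply, E3, smul_h1]; simp

theorem A3_one_E1_add_E2 : A3 1 (E1 + E2) = (0 : ℝ) • (E1 + E2) := by
  rw [A3_one_apply, E1, E2, h1_add, smul_h1]; simp

theorem A3_one_Pminus : A3 1 Pminus = (2 : ℝ) • Pminus := by
  rw [A3_one_apply, Pminus, smul_h1]
  congr 1 <;> norm_num

theorem A3_one_E2_sub_E1_sub_F3 : A3 1 (E2 - E1 - F3) = (-2 : ℝ) • (E2 - E1 - F3) := by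
  rw [A3_one_apply, E2, E1, F3, h1_sub, h1_sub, smul_h1]
  congr 1 <;> norm_num

/-- `E₃` has weight `0`, so `D E₃` has weight `±2`. As a derivative of the idempotent `E₃` it lives
in `(x₁, x₂)`, which carries only the weights `±1`. -/
theorem root_two_E3 {c : ℝ} (hc : c ^ 2 = 4) {D : EndJ} (h : D ∈ rootSpace c) : D E3 = 0 := by
  have hD := mem_f4_iff.1 h.1
  obtain ⟨a, b, c', d⟩ := der_E3 hD
  have w := rootSpace_weight h A3_one_E3
  obtain ⟨x, y⟩ := weight_x w (by rw [add_zero, hc]; norm_num)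
  exact J_ext a b c' x y d

/-- `E₂` is a sum of vectors of weights `0, 2, -2`. A short root vector makes these weights odd,
while `x₃` carries only even ones. -/
theorem root_one_E2 {c : ℝ} (hc : c = 1 ∨ c = -1) {D : EndJ} (h : D ∈ rootSpace c) :
    (D E2).2 2 = 0 := by
  have w0 := rootSpace_weight h A3_one_E1_add_E2
  have w1 := rootSpace_weight h A3_one_Pminus
  have w2 := rootSpace_weight h A3_one_E2_sub_E1_sub_F3
  have k0 := (weight_xi w0 (by rcases hc with rfl | rfl <;> norm_num)
    (by rcases hc with rfl | rfl <;> norm_num)).2.2.2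
  have k1 := (weight_xi w1 (by rcases hc with rfl | rfl <;> norm_num)
    (by rcases hc with rfl | rfl <;> norm_num)).2.2.2
  have k2 := (weight_xi w2 (by rcases hc with rfl | rfl <;> norm_num)
    (by rcases hc with rfl | rfl <;> norm_num)).2.2.2
  have e : E2 = (1 / 2 : ℝ) • (E1 + E2) + (1 / 4 : ℝ) • Pminus + (1 / 4 : ℝ) • (E2 - E1 - F3) := by
    rw [sub_eq_P]; module
  rw [e, map_add, map_add, map_smul, map_smul, map_smul]
  simp only [Prod.snd_add, Prod.smul_snd, Pi.add_apply, Pi.smul_apply, k0, k1, k2, smul_zero,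
    add_zero]

theorem theta_rootSpace {c : ℝ} {D : EndJ} (h : brk (A3 1) D = c • D) :
    brk (A3 1) (theta D) = (-c) • theta D := by
  have e : A3 1 = -theta (A3 1) := by rw [theta_A3, neg_neg]
  rw [e, ← neg_one_smul ℝ (theta (A3 1)), smul_brk, ← theta_brk, h, theta_smul]
  module

/-- Eigenvectors of `ad Ã₃¹(1)` to distinct eigenvalues are linearly independent. -/
theorem ad_A3_independent {Z A A' B B' : EndJ} (hZ : brk (A3 1) Z = 0)
    (hA : brk (A3 1) A = (1 : ℝ) • A) (hA' : brk (A3 1) A' = (2 : ℝ) • A')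
    (hB : brk (A3 1) B = (-1 : ℝ) • B) (hB' : brk (A3 1) B' = (-2 : ℝ) • B')
    (h : Z + A + A' + B + B' = 0) : Z = 0 ∧ A = 0 ∧ A' = 0 ∧ B = 0 ∧ B' = 0 := by
  have hz : brk (A3 1) 0 = 0 := by simp [brk]
  have k1 := congrArg (brk (A3 1)) h
  simp only [brk_add, hZ, hA, hA', hB, hB', hz, zero_add] at k1
  have k2 := congrArg (brk (A3 1)) k1
  simp only [brk_add, brk_smul, hA, hA', hB, hB', hz] at k2
  have k3 := congrArg (brk (A3 1)) k2
  simp only [brk_add, brk_smul, hA, hA', hB, hB', hz] at k3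
  have k4 := congrArg (brk (A3 1)) k3
  simp only [brk_add, brk_smul, hA, hA', hB, hB', hz] at k4
  -- Lagrange interpolation at the eigenvalues `0, ±1, ±2`: the coefficients are those of the
  -- polynomial `-x(x+1)(x²-4)/6`, equal to `1` at `1` and to `0` at the others. The next three
  -- projections arise in the same way.
  have a1 : A = 0 := by
    linear_combination (norm := module) (-1 / 6 : ℝ) • k4 + (-1 / 6 : ℝ) • k3
      + (4 / 6 : ℝ) • k2 + (4 / 6 : ℝ) • k1
  have a2 : B = 0 := by
    linear_combination (norm := module) (-1 / 6 : ℝ) • k4 + (1 / 6 : ℝ) • k3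
      + (4 / 6 : ℝ) • k2 + (-4 / 6 : ℝ) • k1
  have a3 : A' = 0 := by
    linear_combination (norm := module) (1 / 24 : ℝ) • k4 + (2 / 24 : ℝ) • k3
      + (-1 / 24 : ℝ) • k2 + (-2 / 24 : ℝ) • k1
  have a4 : B' = 0 := by
    linear_combination (norm := module) (1 / 24 : ℝ) • k4 + (-2 / 24 : ℝ) • k3
      + (-1 / 24 : ℝ) • k2 + (2 / 24 : ℝ) • k1
  subst a1 a2 a3 a4
  simpa using h

/-- The subalgebra `𝔨_ε` annihilates `E₂`. -/
theorem lieKeps_E2 {X : EndJ} (h : X ∈ lieKeps) : X E2 = 0 := by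
  obtain ⟨H, ⟨s, rfl⟩, D, hD, U₁, hU₁, U₂, hU₂, V₁, hV₁, V₂, hV₂, e, e'⟩ := h
  have u1 := mem_rootSpace_iff.1 hU₁
  have u2 := mem_rootSpace_iff.1 hU₂
  have v1 := mem_rootSpace_iff.1 hV₁
  have v2 := mem_rootSpace_iff.1 hV₂
  -- The equation `X - θ_ε X = 0`, sorted by eigenvalues of `ad Ã₃¹(1)`; `θ` exchanges opposite root
  -- spaces, and the `𝔪`-part cancels.
  have key := ad_A3_independent (Z := (2 * s) • A3 1) (A := U₁ + theta V₁) (A' := U₂ - theta V₂)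
    (B := V₁ + theta U₁) (B' := V₂ - theta U₂) (by simp [brk])
    (by rw [brk_add, u1.2, theta_rootSpace v1.2]; module)
    (by rw [brk_sub, u2.2, theta_rootSpace v2.2]; module)
    (by rw [brk_add, v1.2, theta_rootSpace u1.2]; module)
    (by rw [brk_sub, v2.2, theta_rootSpace u2.2]; module)
    (by
      have := e.symm.trans e'
      rw [theta_smul, theta_A3, hD.2.1] at this
      linear_combination (norm := module) this)
  obtain ⟨k0, -, -, k1, k2⟩ := key
  have hH : s • A3 1 = 0 := by
    rw [mul_smul] at k0
    exact (smul_eq_zero.1 k0).resolve_left two_ne_zero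
  -- The long part is `θ`-even, so it kills `E₁`. It kills `E₃` by weights and the unit as a
  -- derivation, hence also `E₂`.
  have w2 : (U₂ + V₂) E2 = 0 := by
    have hd : IsDer (U₂ + V₂) := u2.1.add v2.1
    have t : theta (U₂ + V₂) = U₂ + V₂ := by
      rw [sub_eq_zero.1 k2, theta_add, theta_theta, add_comm]
    have z1 := der_E1_eq_zero hd t
    have z3 : (U₂ + V₂) E3 = 0 := by
      rw [add_apply, root_two_E3 (by norm_num) hU₂, root_two_E3 (by norm_num) hV₂, add_zero]
    have z := der_one hd
    rw [map_add, map_add, z1, z3, add_zero, zero_add] at z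
    exact z
  -- The short part is `θ`-odd. The Peirce `1/2`-space of `E₂` leaves only `x₁` and `x₃`: the first
  -- vanishes by `σ`-parity, the second by weights.
  have w1 : (U₁ + V₁) E2 = 0 := by
    have hd : IsDer (U₁ + V₁) := u1.1.add v1.1
    have t : theta (U₁ + V₁) = -(U₁ + V₁) := by
      rw [eq_neg_of_add_eq_zero_left k1, theta_add, ← neg_one_smul ℝ (theta U₁), theta_smul,
        theta_theta]
      module
    obtain ⟨a, b, c, d⟩ := der_E2 hd
    have x2 : ((U₁ + V₁) E2).2 2 = 0 := by
      rw [add_apply, Prod.snd_add, Pi.add_apply, root_one_E2 (Or.inl rfl) hU₁,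
        root_one_E2 (Or.inr rfl) hV₁, add_zero]
    have x0 : ((U₁ + V₁) E2).2 0 = 0 := by
      have q := congrArg (fun E : EndJ => (E E2).2 0) t
      simp only [theta_apply, sigma_E2] at q
      rw [sigma_apply, h1_x0] at q
      exact oct_eq_zero_of_eq_neg q
    exact J_ext a b c x0 d x2
  have sum : X = D + (U₁ + V₁) + (U₂ + V₂) := by rw [e, hH]; abel
  rw [sum, add_apply, add_apply, w1, w2, lieM_E2 hD]
  simp

/-! ### Automorphisms and idempotents -/

theorem F4_jmul {g : EndJˣ} (hg : g ∈ F4) (X Y : J) :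
    (g : EndJ) (jmul X Y) = jmul ((g : EndJ) X) ((g : EndJ) Y) := hg X Y

/-- The idempotent `g E₁` is primitive. -/
theorem exists_smul_of_jmul_E1 {g : EndJˣ} (hg : g ∈ F4) {Z : J}
    (h : jmul ((g : EndJ) E1) Z = Z) : ∃ c : ℝ, Z = c • (g : EndJ) E1 := by
  have e := F4_jmul (F4.inv_mem hg) ((g : EndJ) E1) Z
  rw [h, units_inv_apply, jmul_E1] at e
  generalize hW : ((g⁻¹ : EndJˣ) : EndJ) Z = W at e
  have k0 : W.2 0 = 0 := congrArg (fun X : J => X.2 0) e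
  have k1 : W.2 1 = (1 / 2 : ℝ) • W.2 1 := congrArg (fun X : J => X.2 1) e
  have k2 : W.2 2 = (1 / 2 : ℝ) • W.2 2 := congrArg (fun X : J => X.2 2) e
  have half : ∀ x : Oct ℝ, x = (1 / 2 : ℝ) • x → x = 0 := fun x hx => by
    have : (1 / 2 : ℝ) • x = 0 := by linear_combination (norm := module) hx
    exact (smul_eq_zero.1 this).resolve_left (by norm_num)
  have m1 : W.1 1 = 0 := congrArg (fun X : J => X.1 1) e
  have m2 : W.1 2 = 0 := congrArg (fun X : J => X.1 2) e
  refine ⟨W.1 0, ?_⟩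
  have : W = W.1 0 • E1 := by
    rw [E1, smul_h1]
    refine J_ext ?_ ?_ ?_ ?_ ?_ ?_ <;> simp only [h1_xi0, h1_xi1, h1_xi2, h1_x0, h1_x1, h1_x2]
    · ring
    · rw [m1]; ring
    · rw [m2]; ring
    · rw [k0, smul_zero]
    · rw [half _ k1, smul_zero]
    · rw [half _ k2, smul_zero]
  rw [← map_smul, ← this, ← hW, units_apply_inv]

/-- `E₂ + E₃` is not primitive: multiplication by it fixes `E₂`, which is not one of its multiples.
The next lemma excludes `E₁ + E₃` likewise. -/
theorem F4_E1_ne_E2_add_E3 {g : EndJˣ} (hg : g ∈ F4) : (g : EndJ) E1 ≠ h1 0 1 1 0 0 0 := by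
  intro h
  obtain ⟨c, hc⟩ := exists_smul_of_jmul_E1 hg (Z := E2) (by rw [h, E2, jmul_h1]; simp)
  rw [h, E2, smul_h1] at hc
  have e1 := congrArg (fun X : J => X.1 1) hc
  have e2 := congrArg (fun X : J => X.1 2) hc
  simp only [h1_xi1, h1_xi2] at e1 e2
  linarith

theorem F4_E1_ne_E1_add_E3 {g : EndJˣ} (hg : g ∈ F4) : (g : EndJ) E1 ≠ h1 1 0 1 0 0 0 := by
  intro h
  obtain ⟨c, hc⟩ := exists_smul_of_jmul_E1 hg (Z := E1) (by rw [h, jmul_comm, jmul_E1, E1]; simp)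
  rw [h, E1, smul_h1] at hc
  have e1 := congrArg (fun X : J => X.1 0) hc
  have e2 := congrArg (fun X : J => X.1 2) hc
  simp only [h1_xi0, h1_xi2] at e1 e2
  linarith

theorem F4_E1_sq {g : EndJˣ} (hg : g ∈ F4) :
    jmul ((g : EndJ) E1) ((g : EndJ) E1) = (g : EndJ) E1 := by
  rw [← F4_jmul hg, E1_sq]

/-! ### The groups `K` and `M` as stabilizers in the Jordan algebra. -/

theorem grpK_sigma {g : EndJˣ} (hg : g ∈ grpK) (X : J) :
    (g : EndJ) ((sigma : EndJ) X) = (sigma : EndJ) ((g : EndJ) X) := by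
  have h : sigma * g = g * sigma := by
    have := hg.2
    rwa [mul_inv_eq_iff_eq_mul] at this
  rw [← units_mul_apply, ← units_mul_apply, h]

theorem grpK_inv {g : EndJˣ} (hg : g ∈ grpK) : g⁻¹ ∈ grpK := by
  refine ⟨F4.inv_mem hg.1, ?_⟩
  have := congrArg (·⁻¹) hg.2
  simpa [mul_assoc] using this

/-- The group `K` fixes `E₁`. -/
theorem grpK_E1 {g : EndJˣ} (hg : g ∈ grpK) : (g : EndJ) E1 = E1 := by
  -- The `σ`-odd elements form the Peirce `1/2`-space of `E₁`, and `g⁻¹` preserves them;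
  -- transporting by `g` makes them `1/2`-eigenvectors of `g E₁`.
  have odd : ∀ Z : J, (sigma : EndJ) Z = -Z → jmul ((g : EndJ) E1) Z = (1 / 2 : ℝ) • Z := by
    intro Z hZ
    have hW := grpK_sigma (grpK_inv hg) Z
    rw [hZ, map_neg] at hW
    generalize hW' : ((g⁻¹ : EndJˣ) : EndJ) Z = W at hW
    rw [sigma_apply] at hW
    have a : W.1 0 = 0 := by
      have : -W.1 0 = W.1 0 := congrArg (fun X : J => X.1 0) hW
      linarith
    have b : W.1 1 = 0 := by
      have : -W.1 1 = W.1 1 := congrArg (fun X : J => X.1 1) hW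
      linarith
    have c : W.1 2 = 0 := by
      have : -W.1 2 = W.1 2 := congrArg (fun X : J => X.1 2) hW
      linarith
    have d : W.2 0 = 0 := by
      have : -W.2 0 = W.2 0 := congrArg (fun X : J => X.2 0) hW
      exact oct_eq_zero_of_eq_neg this.symm
    have e : jmul E1 W = (1 / 2 : ℝ) • W := by
      rw [jmul_E1, a]
      refine J_ext ?_ ?_ ?_ ?_ rfl rfl
      · simp [a]
      · simp [b]
      · simp [c]
      · simp [d]
    have := congrArg (g : EndJ) e
    rwa [F4_jmul hg.1, map_smul, ← hW', units_apply_inv] at this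
  have even : (sigma : EndJ) ((g : EndJ) E1) = (g : EndJ) E1 := by
    rw [← grpK_sigma hg, sigma_E1]
  have sq := F4_E1_sq hg.1
  have ne := F4_E1_ne_E2_add_E3 hg.1
  generalize (g : EndJ) E1 = Y at odd even sq ne
  rw [sigma_apply] at even
  have y1 : Y.2 1 = 0 := oct_eq_zero_of_eq_neg (congrArg (fun X : J => X.2 1) even).symm
  have y2 : Y.2 2 = 0 := oct_eq_zero_of_eq_neg (congrArg (fun X : J => X.2 2) even).symm
  -- These two test vectors force `ξ₁ + ξ₃ = 1`, `ξ₁ + ξ₂ = 1` and `x₁ = 0`. Idempotency then leaves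
  -- `E₁` and `E₂ + E₃`, and the latter is not primitive.
  have o1 := odd (h1 0 0 0 0 1 0) (by rw [sigma_apply, neg_h1]; simp)
  have o2 := odd (h1 0 0 0 0 0 1) (by rw [sigma_apply, neg_h1]; simp)
  rw [← h1_eta Y, y1, y2, jmul_h1, smul_h1] at o1 o2
  have p1 := congrArg (fun X : J => (X.2 1).c 0) o1
  have p2 := congrArg (fun X : J => (X.2 2).c 0) o2
  have p3 := congrArg (fun X : J => X.2 2) o1
  simp at p1 p2 p3
  have y0 : Y.2 0 = 0 := by
    rw [← Oct.conj_conj (Y.2 0), p3, Oct.conj_zero]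
  rw [← h1_eta Y, y0, y1, y2, jmul_h1] at sq
  have s0 := congrArg (fun X : J => X.1 0) sq
  simp at s0
  have s0' : Y.1 0 = 0 ∨ Y.1 0 = 1 := by
    have : Y.1 0 * (Y.1 0 - 1) = 0 := by linarith
    rcases mul_eq_zero.1 this with h | h
    · exact Or.inl h
    · exact Or.inr (by linarith)
  rcases s0' with h | h
  · refine absurd (J_ext h ?_ ?_ y0 y1 y2) ne
    · rw [h1_xi1]; linarith
    · rw [h1_xi2]; linarith
  · refine J_ext h ?_ ?_ y0 y1 y2
    · rw [E1, h1_xi1]; linarith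
    · rw [E1, h1_xi2]; linarith

/-- The polynomial `1 - 8x + 8x²` takes the values `1, -1, 1` at the Peirce eigenvalues `0, 1/2, 1`.
Hence every automorphism fixing `E₁` commutes with `σ`. -/
theorem sigma_eq_jmul (X : J) : (sigma : EndJ) X =
    X - (8 : ℝ) • jmul E1 X + (8 : ℝ) • jmul E1 (jmul E1 X) := by
  rw [sigma_apply, jmul_E1, jmul_E1]
  conv_rhs => rw [← h1_eta X]
  rw [smul_h1, smul_h1, h1_sub, h1_add]
  simp only [h1_xi0, h1_xi1, h1_xi2, h1_x0, h1_x1, h1_x2]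
  congr 1 <;> module

theorem jmul_F3 (X : J) : jmul F3 X = h1 (-(X.2 2).c 0) (-(X.2 2).c 0) 0
    (-(1 / 2 : ℝ) • (X.2 1).conj) ((1 / 2 : ℝ) • (X.2 0).conj)
    ((1 / 2 : ℝ) • (X.1 0 + X.1 1) • 1) := by
  rw [← h1_eta X, F3, jmul_h1]
  simp only [h1_xi0, h1_xi1, h1_xi2, h1_x0, h1_x1, h1_x2, Oct.one_ip, Oct.zero_ip, zero_mul,
    mul_zero, mul_one, one_mul, zero_add, add_zero, smul_zero, zero_sub, sub_zero, smul_neg,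
    neg_smul, Oct.conj_zero, zero_smul]

/-- This exhibits `Ã₃¹(1)` as an inner derivation, so every automorphism fixing `E₁` and `F3`
commutes with it. -/
theorem A3_one_eq_jmul (X : J) : A3 1 X =
    (4 : ℝ) • (jmul E1 (jmul F3 X) - jmul F3 (jmul E1 X)) := by
  rw [A3_one_apply, jmul_E1, jmul_E1, jmul_F3, jmul_F3, h1_sub, smul_h1]
  simp only [h1_xi0, h1_xi1, h1_xi2, h1_x0, h1_x1, h1_x2, Oct.smul_c, Pi.smul_apply, smul_eq_mul,
    Oct.conj_smul, Oct.conj_zero]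
  congr 1
  · ring
  · ring
  · ring
  all_goals module

theorem mem_grpM_iff {g : EndJˣ} : g ∈ grpM ↔
    g ∈ grpK ∧ ∀ X, (g : EndJ) (A3 1 X) = A3 1 ((g : EndJ) X) := by
  refine and_congr_right fun _ => ⟨fun h X => ?_, fun h => ContinuousLinearMap.ext fun X => ?_⟩
  · conv_rhs => rw [← h]
    simp only [EndJ_mul_apply, units_inv_apply]
  · rw [EndJ_mul_apply, EndJ_mul_apply, h, units_apply_inv]

theorem grpM_F3 {g : EndJˣ} (hg : g ∈ grpM) : (g : EndJ) F3 = F3 := by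
  rw [mem_grpM_iff] at hg
  have h := hg.2 E1
  rw [grpK_E1 hg.1, A3_one_E1, map_neg] at h
  exact neg_injective h

theorem grpM_E2 {g : EndJˣ} (hg : g ∈ grpM) : (g : EndJ) E2 = E2 := by
  have h := F4_jmul hg.1.1 F3 F3
  rw [grpM_F3 hg, F3_sq, map_neg, map_add, grpK_E1 hg.1] at h
  exact add_left_cancel (neg_injective h)

theorem grpM_Pminus {g : EndJˣ} (hg : g ∈ grpM) : (g : EndJ) Pminus = Pminus := by
  rw [sub_eq_P, map_add, map_sub, grpM_F3 hg, grpM_E2 hg, grpK_E1 hg.1]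

theorem jmul_E1_Pminus : jmul E1 Pminus = (1 / 2 : ℝ) • F3 - E1 := by
  rw [jmul_E1, Pminus, F3, E1, smul_h1, h1_sub]
  simp

/-- `F3` is recovered from `E₁` and `P⁻` through `E₁ ∘ P⁻`, so `g` fixes it too; `sigma_eq_jmul` and
`A3_one_eq_jmul` then give both commutation relations that define `M`. -/
theorem mem_grpM_of_fix {g : EndJˣ} (hg : g ∈ F4) (h1 : (g : EndJ) E1 = E1)
    (hP : (g : EndJ) Pminus = Pminus) : g ∈ grpM := by
  have hF : (g : EndJ) F3 = F3 := by
    have h := F4_jmul hg E1 Pminus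
    rw [h1, hP, jmul_E1_Pminus, map_sub, map_smul, h1] at h
    exact smul_right_injective J (by norm_num : (1 / 2 : ℝ) ≠ 0) (sub_left_injective h)
  refine mem_grpM_iff.2 ⟨⟨hg, ?_⟩, fun X => ?_⟩
  · rw [mul_inv_eq_iff_eq_mul]
    refine Units.ext (ContinuousLinearMap.ext fun X => ?_)
    rw [units_mul_apply, units_mul_apply, sigma_eq_jmul, sigma_eq_jmul, map_add, map_sub, map_smul,
      map_smul, F4_jmul hg, F4_jmul hg, F4_jmul hg, h1]
  · rw [A3_one_eq_jmul, A3_one_eq_jmul, map_smul, map_sub]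
    simp only [F4_jmul hg, h1, hF]

theorem one_mem_grpM : (1 : EndJˣ) ∈ grpM := mem_grpM_of_fix F4.one_mem rfl rfl

theorem grpM_mul {g h : EndJˣ} (hg : g ∈ grpM) (hh : h ∈ grpM) : g * h ∈ grpM :=
  mem_grpM_of_fix (F4.mul_mem hg.1.1 hh.1.1)
    (by rw [units_mul_apply, grpK_E1 hh.1, grpK_E1 hg.1])
    (by rw [units_mul_apply, grpM_Pminus hh, grpM_Pminus hg])

theorem units_inv_fix {g : EndJˣ} {X : J} (h : (g : EndJ) X = X) :
    ((g⁻¹ : EndJˣ) : EndJ) X = X := by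
  conv_lhs => rw [← h, units_inv_apply]

theorem grpM_inv {g : EndJˣ} (hg : g ∈ grpM) : g⁻¹ ∈ grpM :=
  mem_grpM_of_fix (F4.inv_mem hg.1.1) (units_inv_fix (grpK_E1 hg.1))
    (units_inv_fix (grpM_Pminus hg))

/-- Automorphisms that fix `E₂` preserve the coordinate `ξ₂`. -/
theorem xi_of_fix_E2 {g : EndJˣ} (hg : g ∈ F4) (h : (g : EndJ) E2 = E2) (X : J) :
    ((g : EndJ) X).1 1 = X.1 1 := by
  -- The polynomial `2x² - x` vanishes at `0` and `1/2` and is `1` at `1`: this is the Peirce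
  -- projection onto `ℝ E₂`.
  have key : ∀ X : J, (2 : ℝ) • jmul E2 (jmul E2 X) - jmul E2 X = X.1 1 • E2 := fun X => by
    rw [jmul_E2, jmul_E2, E2, smul_h1, smul_h1, h1_sub]
    simp only [h1_xi0, h1_xi1, h1_xi2, h1_x0, h1_x1, h1_x2]
    congr 1
    · ring
    · ring
    · ring
    all_goals module
  have e := congrArg (g : EndJ) (key X)
  rw [map_sub, map_smul, F4_jmul hg, F4_jmul hg, h, map_smul, h, key] at e
  have := congrArg (fun X : J => X.1 1) e
  simpa [E2] using this

/-! ### The element `P⁻` -/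

/-- The linear form `(P⁻ | X)`. -/
def pairP (X : J) : ℝ := X.1 1 - X.1 0 - 2 * (X.2 2).c 0

theorem jmul_Pminus (X : J) : jmul Pminus X = h1 (-X.1 0 - (X.2 2).c 0) (X.1 1 - (X.2 2).c 0) 0
    ((1 / 2 : ℝ) • (X.2 0 - (X.2 1).conj)) ((1 / 2 : ℝ) • ((X.2 0).conj - X.2 1))
    ((1 / 2 : ℝ) • (X.1 0 + X.1 1) • 1) := by
  rw [sub_eq_P, add_jmul, sub_jmul, jmul_E1, jmul_E2, jmul_F3, h1_sub, h1_add]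
  congr 1
  · ring
  · ring
  · ring
  all_goals module

/-- This writes the form `(P⁻ | ·)` in terms of the Jordan product alone, which makes its behaviour
under automorphisms visible. -/
theorem jmul_Pminus_Pminus (X : J) :
    (2 : ℝ) • jmul Pminus (jmul Pminus X) = pairP X • Pminus := by
  rw [jmul_Pminus, jmul_Pminus, pairP, Pminus, smul_h1, smul_h1]
  simp only [h1_xi0, h1_xi1, h1_xi2, h1_x0, h1_x1, h1_x2, Oct.smul_c, Oct.one_c, Pi.smul_apply,
    smul_eq_mul, Matrix.cons_val, Oct.conj_smul, Oct.conj_sub, Oct.conj_conj]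
  congr 1
  · ring
  · ring
  · ring
  all_goals module

theorem Pminus_sq : jmul Pminus Pminus = 0 := by
  rw [jmul_Pminus, ← h1_zero, Pminus]; simp

theorem Pminus_ne_zero : Pminus ≠ 0 := fun h => by
  have := congrArg (fun X : J => X.1 1) h
  simp [Pminus] at this

/-- The scalar by which an automorphism multiplies `P⁻` also governs its effect on `(P⁻ | ·)`. -/
theorem pairP_of_smul {g : EndJˣ} (hg : g ∈ F4) {s : ℝ} (h : (g : EndJ) Pminus = s • Pminus)
    (X : J) : s ^ 2 * pairP ((g : EndJ) X) = s * pairP X := by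
  have e := congrArg (g : EndJ) (jmul_Pminus_Pminus X)
  rw [map_smul, F4_jmul hg, F4_jmul hg, h, map_smul, h, smul_jmul, smul_jmul, jmul_smul] at e
  have e' : (s ^ 2 * pairP ((g : EndJ) X)) • Pminus = (s * pairP X) • Pminus := by
    rw [mul_smul, ← jmul_Pminus_Pminus, mul_comm s, mul_smul, ← e]
    module
  exact smul_left_injective ℝ Pminus_ne_zero e'

/-- On squares `(P⁻ | ·)` is nonnegative as soon as `ξ₁ + ξ₂ = 0`. This is the source of positivity
in `pos_of_Pminus_smul`. -/
theorem pairP_sq (Y : J) : pairP (jmul Y Y) =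
    (Y.1 0 + Y.1 1) * (Y.1 1 - Y.1 0 - 2 * (Y.2 2).c 0)
      + ((Y.2 0).conj - Y.2 1).ip ((Y.2 0).conj - Y.2 1) := by
  rw [pairP, jmul]
  simp only [h1_xi0, h1_xi1, h1_xi2, h1_x0, h1_x1, h1_x2, Oct.ip_eq, Oct.conj_c, Oct.mul_c,
    Oct.add_c, Oct.sub_c, Oct.neg_c, Oct.smul_c, Oct.one_c, Pi.add_apply, Pi.sub_apply,
    Pi.neg_apply, Pi.smul_apply, smul_eq_mul, Matrix.cons_val]
  ring

/-- The imaginary unit `e₁` of the octonions. -/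
def e1 : Oct ℝ := ⟨![0, 1, 0, 0, 0, 0, 0, 0]⟩

theorem pairP_span_sq (a b : ℝ) : pairP (jmul (h1 0 0 0 (a • 1 + b • e1) 0 0)
    (h1 0 0 0 (a • 1 + b • e1) 0 0)) = a ^ 2 + b ^ 2 := by
  rw [pairP_sq]
  simp only [h1_xi0, h1_xi1, h1_xi2, h1_x0, h1_x1, h1_x2, sub_zero, Oct.ip_conj_conj]
  simp [Oct.ip_eq, e1]
  ring

theorem h1_span (a b : ℝ) : h1 0 0 0 (a • 1 + b • e1) 0 0 =
    a • h1 0 0 0 1 0 0 + b • h1 0 0 0 e1 0 0 := by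
  rw [smul_h1, smul_h1, h1_add]; simp

/-- No automorphism maps `P⁻` to a negative multiple of `P⁻`. -/
theorem pos_of_Pminus_smul {g : EndJˣ} (hg : g ∈ F4) {s : ℝ}
    (h : (g : EndJ) Pminus = s • Pminus) (hs : s ≠ 0) : 0 < s := by
  set l : J → ℝ := fun X => ((g : EndJ) X).1 0 + ((g : EndJ) X).1 1 with hl
  -- A linear form on the plane spanned by the `x₁`-vectors `1` and `e₁` has a nonzero kernel vector
  -- `Z`. Then `(P⁻ | Z ∘ Z) = a² + b² > 0`, while `(P⁻ | gZ ∘ gZ) ≥ 0` because `ξ₁ + ξ₂` vanishes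
  -- at `gZ`.
  obtain ⟨a, b, hab, hl0⟩ : ∃ a b : ℝ, 0 < a ^ 2 + b ^ 2 ∧
      a * l (h1 0 0 0 1 0 0) + b * l (h1 0 0 0 e1 0 0) = 0 := by
    by_cases hz : l (h1 0 0 0 1 0 0) = 0
    · exact ⟨1, 0, by norm_num, by rw [hz]; ring⟩
    · exact ⟨-l (h1 0 0 0 e1 0 0), l (h1 0 0 0 1 0 0), by positivity, by ring⟩
  have key := pairP_of_smul hg h (jmul (h1 0 0 0 (a • 1 + b • e1) 0 0)
    (h1 0 0 0 (a • 1 + b • e1) 0 0))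
  rw [F4_jmul hg, pairP_span_sq, pairP_sq] at key
  have hl1 : l (h1 0 0 0 (a • 1 + b • e1) 0 0) = 0 := by
    rw [h1_span, hl]
    simp only [hl] at hl0
    refine Eq.trans ?_ hl0
    simp only [map_add, map_smul, Prod.fst_add, Prod.smul_fst, Pi.add_apply, Pi.smul_apply,
      smul_eq_mul]
    ring
  simp only [hl] at hl1
  rw [hl1, zero_mul, zero_add] at key
  have nn := mul_nonneg (sq_nonneg s) (Oct.ip_self_nonneg ((((g : EndJ)
    (h1 0 0 0 (a • 1 + b • e1) 0 0)).2 0).conj - ((g : EndJ) (h1 0 0 0 (a • 1 + b • e1) 0 0)).2 1))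
  rw [key] at nn
  by_contra hneg
  have : s < 0 := lt_of_le_of_ne (not_lt.1 hneg) hs
  nlinarith

/-! ### The stabilizer of `P⁻` -/

/-- The general element of `𝔫⁺`. -/
def nil (a p : Oct ℝ) : EndJ := (A1 a + A2 a.conj) + (rot p + A3 p)

theorem nil_mem (a : Oct ℝ) {p : Oct ℝ} (hp : p.c 0 = 0) : nil a p ∈ lieN :=
  Set.add_mem_add (A1_add_A2_mem a) (rot_add_A3_mem hp)

theorem nil_apply (a : Oct ℝ) {p : Oct ℝ} (hp : p.c 0 = 0) (X : J) : nil a p X =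
    h1 (-2 * a.conj.ip (X.2 1) - 2 * p.ip (X.2 2)) (2 * a.ip (X.2 0) + 2 * p.ip (X.2 2))
      (-2 * a.ip (X.2 0) + 2 * a.conj.ip (X.2 1))
      ((X.1 2 - X.1 1) • a + (a.conj * X.2 2).conj + (p * X.2 0 + (X.2 1 * p).conj))
      (-(X.2 2 * a).conj + (X.1 2 - X.1 0) • a.conj + (X.2 1 * p + (p * X.2 0).conj))
      ((a * X.2 1).conj + (X.2 0 * a.conj).conj
        + ((2 * p.ip (X.2 2)) • 1 - (2 * (X.2 2).c 0) • p + (X.1 1 - X.1 0) • p)) := by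
  rw [nil, add_apply, add_apply, add_apply, A1_apply, A2_apply, A3_apply, rot_apply hp, h1_add,
    h1_add, h1_add]
  congr 1 <;> ring

/-- `P⁻` has weight `2`, the highest one; a positive root vector would raise it to a weight that
does not occur. -/
theorem lieN_Pminus {D : EndJ} (h : D ∈ lieN) : D Pminus = 0 := by
  have z : ∀ {c : ℝ} {U : EndJ}, 0 < c → U ∈ rootSpace c → U Pminus = 0 := fun {c U} hc hU => by
    have w := rootSpace_weight hU A3_one_Pminus
    obtain ⟨a, b⟩ := weight_x w (by nlinarith)
    obtain ⟨d, e, f, g⟩ := weight_xi w (by linarith) (by nlinarith)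
    exact J_ext d e f a b g
  obtain ⟨U, hU, V, hV, rfl⟩ := h
  rw [add_apply, z one_pos hU, z two_pos hV, add_zero]

theorem grpN_Pminus {n : EndJˣ} (h : n ∈ grpN) : (n : EndJ) Pminus = Pminus := by
  obtain ⟨D, hD, rfl⟩ := h
  have := exp_apply_eq_self (lieN_Pminus hD) 1
  rwa [one_smul] at this

theorem lieN_subset_f4 {D : EndJ} (h : D ∈ lieN) : D ∈ f4 := by
  obtain ⟨U, hU, V, hV, rfl⟩ := h
  exact mem_f4_iff.2 ((mem_f4_iff.1 hU.1).add (mem_f4_iff.1 hV.1))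

theorem grpN_mem_F4 {n : EndJˣ} (h : n ∈ grpN) : n ∈ F4 := by
  obtain ⟨D, hD, rfl⟩ := h
  exact expU_mem_F4 (lieN_subset_f4 hD)

/-- The linear form `(P⁻ | ·)`, bundled. -/
def pairPL : J →L[ℝ] ℝ := LinearMap.toContinuousLinearMap
  { toFun := pairP
    map_add' := fun X Y => by
      simp only [pairP, Prod.fst_add, Prod.snd_add, Pi.add_apply, Oct.add_c]; ring
    map_smul' := fun r X => by
      simp only [pairP, Prod.smul_fst, Prod.smul_snd, Pi.smul_apply, Oct.smul_c, smul_eq_mul,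
        RingHom.id_apply]
      ring }

/-- The component of weight `-1`. -/
def wtL : J →L[ℝ] Oct ℝ := LinearMap.toContinuousLinearMap
  { toFun := fun X => X.2 0 - (X.2 1).conj
    map_add' := fun X Y => by
      simp only [Prod.snd_add, Pi.add_apply, Oct.conj_add]; abel
    map_smul' := fun r X => by
      simp only [Prod.smul_snd, Pi.smul_apply, Oct.conj_smul, RingHom.id_apply, smul_sub] }

/-- The imaginary part of `x₃`. -/
def imL : J →L[ℝ] Oct ℝ := LinearMap.toContinuousLinearMap
  { toFun := fun X => X.2 2 - (X.2 2).c 0 • 1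
    map_add' := fun X Y => by
      simp only [Prod.snd_add, Pi.add_apply, Oct.add_c]; module
    map_smul' := fun r X => by
      simp only [Prod.smul_snd, Pi.smul_apply, Oct.smul_c, smul_eq_mul, RingHom.id_apply]
      module }

theorem pairPL_apply (X : J) : pairPL X = X.1 1 - X.1 0 - 2 * (X.2 2).c 0 := rfl

theorem wtL_apply (X : J) : wtL X = X.2 0 - (X.2 1).conj := rfl

theorem imL_apply (X : J) : imL X = X.2 2 - (X.2 2).c 0 • 1 := rfl

/-- The forms `pairPL`, `wtL`, `imL` are triangular under `𝔫⁺`: each is sent to an expression in the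
earlier ones. With `comp_exp_apply` this evaluates the exponential on them without computing it in
full. -/
theorem pairPL_nil (a : Oct ℝ) {p : Oct ℝ} (hp : p.c 0 = 0) (X : J) : pairPL (nil a p X) = 0 := by
  rw [pairPL_apply, nil_apply a hp]
  simp only [h1_xi0, h1_xi1, h1_xi2, h1_x0, h1_x1, h1_x2, Oct.ip_eq, Oct.conj_c, Oct.mul_c,
    Oct.add_c, Oct.sub_c, Oct.neg_c, Oct.smul_c, Oct.one_c, Pi.add_apply, Pi.sub_apply,
    Pi.neg_apply, Pi.smul_apply, smul_eq_mul, Matrix.cons_val, hp]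
  ring

theorem wtL_nil (a : Oct ℝ) {p : Oct ℝ} (hp : p.c 0 = 0) (X : J) :
    wtL (nil a p X) = -pairPL X • a := by
  rw [pairPL_apply, wtL_apply, nil_apply a hp]
  simp only [h1_x0, h1_x1]
  apply Oct.ext8 <;>
  simp only [Oct.conj_c, Oct.mul_c,
    Oct.add_c, Oct.sub_c, Oct.neg_c, Oct.smul_c, Oct.one_c, Pi.add_apply, Pi.sub_apply,
    Pi.neg_apply, Pi.smul_apply, smul_eq_mul, Matrix.cons_val, hp] <;>
  ring

theorem imL_nil (a : Oct ℝ) {p : Oct ℝ} (hp : p.c 0 = 0) (X : J) :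
    imL (nil a p X) = pairPL X • p + (a * (wtL X).conj - (a * (wtL X).conj).c 0 • 1) := by
  rw [pairPL_apply, wtL_apply, imL_apply, nil_apply a hp]
  simp only [h1_x2]
  apply Oct.ext8 <;>
  simp only [Oct.ip_eq, Oct.conj_c, Oct.mul_c,
    Oct.add_c, Oct.sub_c, Oct.neg_c, Oct.smul_c, Oct.one_c, Pi.add_apply, Pi.sub_apply,
    Pi.neg_apply, Pi.smul_apply, smul_eq_mul, Matrix.cons_val, hp] <;>
  ring

/-- `a ā` is real. This removes the second-order term of `imL` under `exp (nil a p)`. -/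
theorem mul_smul_conj_im (r : ℝ) (a : Oct ℝ) :
    a * (r • a).conj - (a * (r • a).conj).c 0 • 1 = 0 := by
  apply Oct.ext8 <;>
  simp only [Oct.conj_c, Oct.mul_c, Oct.sub_c, Oct.smul_c, Oct.one_c, Oct.zero_c, Pi.sub_apply,
    Pi.smul_apply, Pi.zero_apply, smul_eq_mul, Matrix.cons_val] <;>
  ring

/-- An idempotent `Y` in normal position with respect to `P⁻` is `E₁` or `E₁ + E₃`. -/
theorem idempotent_normal_form {Y : J} (sq : jmul Y Y = Y) (hw : pairPL Y = -1) (hv : wtL Y = 0)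
    (hi : imL Y = 0) : Y = E1 ∨ Y = h1 1 0 1 0 0 0 := by
  rw [pairPL_apply] at hw
  rw [wtL_apply, sub_eq_zero] at hv
  rw [imL_apply, sub_eq_zero] at hi
  have hY := h1_eta Y
  rw [hv, hi] at hY
  generalize Y.1 0 = a at *
  generalize Y.1 1 = b at *
  generalize Y.1 2 = c at *
  generalize Y.2 1 = y at *
  generalize (Y.2 2).c 0 = r at *
  rw [← hY, jmul_h1] at sq
  have s0 := congrArg (fun X : J => X.1 0) sq
  have s1 := congrArg (fun X : J => X.1 1) sq
  have s2 := congrArg (fun X : J => X.1 2) sq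
  have k0 := congrArg (fun X : J => X.2 0) sq
  have k1 := congrArg (fun X : J => X.2 1) sq
  have k2 := congrArg (fun X : J => (X.2 2).c 0) sq
  simp only [h1_xi0, h1_xi1, h1_xi2, h1_x0, h1_x1, h1_x2, Oct.ip_conj_conj, Oct.ip_smul,
    Oct.smul_ip, Oct.one_ip, Oct.one_c, Matrix.cons_val_zero, mul_one, mul_smul_comm,
    smul_mul_assoc, one_mul, Oct.conj_smul, Oct.conj_add, Oct.conj_conj] at s0 s1 s2 k0 k1
  -- If `y ≠ 0`, both scalars vanish and their difference gives `b - a - 2r = 0`, against `hw`.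
  have m0 : (b + c - r - 1) • y.conj = 0 := by linear_combination (norm := module) k0
  have m1 : (c + a + r - 1) • y = 0 := by linear_combination (norm := module) k1
  have hy : y = 0 := by
    by_contra hne
    have q1 := (smul_eq_zero.1 m1).resolve_right hne
    have q0 := (smul_eq_zero.1 m0).resolve_right fun h => hne (by
      rw [← Oct.conj_conj y, h, Oct.conj_zero])
    linarith
  subst hy
  simp only [h1_x2, Oct.conj_zero, zero_mul, add_zero, Oct.smul_c, Oct.one_c, Pi.smul_apply,
    smul_eq_mul, Matrix.cons_val_zero, mul_one, Oct.zero_c, Pi.zero_apply, Oct.add_c,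
    Pi.add_apply] at k2
  rw [Oct.ip_zero] at s0 s1 s2
  have h3 : (a + b - 1) * r = 0 := by linarith
  have h4 : (a - b) * (a + b - 1) = 0 := by linarith
  have hab : a + b = 1 := by
    by_contra hne
    have hne' : a + b - 1 ≠ 0 := sub_ne_zero.2 hne
    have hr := (mul_eq_zero.1 h3).resolve_left hne'
    have hd := (mul_eq_zero.1 h4).resolve_right hne'
    linarith
  have hr : r = b := by linarith
  have hb : b = 0 := by
    have : a = 1 - b := by linarith
    subst this
    rw [hr] at s0
    nlinarith
  have ha : a = 1 := by linarith
  have hc : c = 0 ∨ c = 1 := by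
    have : c * (c - 1) = 0 := by linarith
    rcases mul_eq_zero.1 this with h | h
    · exact Or.inl h
    · exact Or.inr (by linarith)
  rw [← hY, hr, hb, ha, zero_smul, Oct.conj_zero]
  rcases hc with rfl | rfl
  · exact Or.inl rfl
  · exact Or.inr rfl

/-- The stabilizer of `P⁻` is contained in `M N⁺`. -/
theorem stabilizer_Pminus {g : EndJˣ} (hg : g ∈ F4) (h : (g : EndJ) Pminus = Pminus) :
    ∃ m ∈ grpM, ∃ n ∈ grpN, g = m * n := by
  set Y := ((g⁻¹ : EndJˣ) : EndJ) E1 with hY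
  have hg' := F4.inv_mem hg
  -- Since `g⁻¹` fixes `P⁻`, it preserves `(P⁻ | ·)`, whose value at `E₁` is `-1`.
  have hw : pairPL Y = -1 := by
    have := pairP_of_smul hg' (s := 1) (by rw [one_smul]; exact units_inv_fix h) E1
    rw [one_pow, one_mul, one_mul] at this
    rw [hY]
    refine this.trans ?_
    simp [pairP, E1]
  -- As `pairPL Y = -1`, `exp (nil a p)` adds `a` to `wtL Y` and, `a` being parallel to `wtL Y`,
  -- subtracts `p` from `imL Y`. These choices make both vanish.
  set a := -wtL Y with ha
  set p := imL Y with hp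
  have hp0 : p.c 0 = 0 := by rw [hp, imL_apply]; simp
  set n := expU (nil a p) with hn
  have hnN : n ∈ grpN := ⟨_, nil_mem a hp0, rfl⟩
  have hnF := grpN_mem_F4 hnN
  have c1 : pairPL ((n : EndJ) Y) = -1 := by
    rw [hn, expU_val, comp_exp_apply pairPL (fun X => pairPL_nil a hp0 _), pairPL_nil a hp0, hw,
      add_zero]
  have c2 : wtL ((n : EndJ) Y) = 0 := by
    rw [hn, expU_val, comp_exp_apply wtL (fun X => by rw [wtL_nil a hp0, pairPL_nil a hp0]; simp),
      wtL_nil a hp0, hw, ha]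
    module
  have c3 : imL ((n : EndJ) Y) = 0 := by
    rw [hn, expU_val, comp_exp_apply imL (fun X => by
      rw [imL_nil a hp0, pairPL_nil a hp0, wtL_nil a hp0, mul_smul_conj_im]; simp),
      imL_nil a hp0, hw, ← hp]
    have : wtL Y = (-1 : ℝ) • a := by rw [ha]; module
    rw [this, mul_smul_conj_im]
    module
  have hng : n * g⁻¹ ∈ F4 := F4.mul_mem hnF hg'
  have hE : ((n * g⁻¹ : EndJˣ) : EndJ) E1 = E1 := by
    have sq := F4_E1_sq hng
    have ne := F4_E1_ne_E1_add_E3 hng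
    rw [units_mul_apply] at sq ne ⊢
    exact (idempotent_normal_form sq c1 c2 c3).resolve_right ne
  have hP : ((n * g⁻¹ : EndJˣ) : EndJ) Pminus = Pminus := by
    rw [units_mul_apply, units_inv_fix h, grpN_Pminus hnN]
  refine ⟨(n * g⁻¹)⁻¹, grpM_inv (mem_grpM_of_fix hng hE hP), n, hnN, ?_⟩
  group

/-! ### Explicit one-parameter orbits -/

theorem hasDerivAt_h1 {a b c : ℝ → ℝ} {x y z : ℝ → Oct ℝ} {a' b' c' : ℝ} {x' y' z' : Oct ℝ} {t : ℝ}
    (ha : HasDerivAt a a' t) (hb : HasDerivAt b b' t) (hc : HasDerivAt c c' t)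
    (hx : HasDerivAt x x' t) (hy : HasDerivAt y y' t) (hz : HasDerivAt z z' t) :
    HasDerivAt (fun s => h1 (a s) (b s) (c s) (x s) (y s) (z s)) (h1 a' b' c' x' y' z') t := by
  refine HasDerivAt.prodMk (hasDerivAt_pi.2 fun i => ?_) (hasDerivAt_pi.2 fun i => ?_)
  · fin_cases i <;> assumption
  · fin_cases i <;> assumption

/-- The orbit of a one-parameter group of hyperbolic rotations generated by `A2 b`. -/
theorem exp_A2_apply {b : Oct ℝ} (hb : b.ip b = 1) (m d e r : ℝ) (x z : Oct ℝ) (t : ℝ) :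
    NormedSpace.exp (t • A2 b) (h1 (m - d) e (m + d) x (r • b) z) =
      h1 (m - (d * Real.cosh (2 * t) + r * Real.sinh (2 * t))) e
        (m + (d * Real.cosh (2 * t) + r * Real.sinh (2 * t)))
        (Real.cosh t • x + Real.sinh t • (b * z).conj)
        ((r * Real.cosh (2 * t) + d * Real.sinh (2 * t)) • b)
        (Real.cosh t • z + Real.sinh t • (x * b).conj) := by
  have c2 : ∀ s : ℝ, HasDerivAt (fun u : ℝ => Real.cosh (2 * u)) (2 * Real.sinh (2 * s)) s :=
    fun s => by
      simpa [mul_comm] using ((hasDerivAt_id s).const_mul 2).cosh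
  have s2 : ∀ s : ℝ, HasDerivAt (fun u : ℝ => Real.sinh (2 * u)) (2 * Real.cosh (2 * s)) s :=
    fun s => by
      simpa [mul_comm] using ((hasDerivAt_id s).const_mul 2).sinh
  refine exp_apply_eq (γ := fun t => h1 (m - (d * Real.cosh (2 * t) + r * Real.sinh (2 * t))) e
        (m + (d * Real.cosh (2 * t) + r * Real.sinh (2 * t)))
        (Real.cosh t • x + Real.sinh t • (b * z).conj)
        ((r * Real.cosh (2 * t) + d * Real.sinh (2 * t)) • b)
        (Real.cosh t • z + Real.sinh t • (x * b).conj)) (fun s => ?_) (by simp) t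
  refine (hasDerivAt_h1
    ((((c2 s).const_mul d).add ((s2 s).const_mul r)).const_sub m) (hasDerivAt_const s e)
    ((((c2 s).const_mul d).add ((s2 s).const_mul r)).const_add m)
    (((Real.hasDerivAt_cosh s).smul_const x).add ((Real.hasDerivAt_sinh s).smul_const _))
    ((((c2 s).const_mul r).add ((s2 s).const_mul d)).smul_const b)
    (((Real.hasDerivAt_cosh s).smul_const z).add
      ((Real.hasDerivAt_sinh s).smul_const _))).congr_deriv ?_
  -- For a unit `b` the maps between `x₁` and `x₃` in `A2 b` are mutually inverse, which produces
  -- `cosh` and `sinh`.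
  have hx : (b * (x * b).conj).conj = x := by
    rw [Oct.conj_mul x, Oct.mul_conj_cancel, hb, one_smul, Oct.conj_conj]
  have hz : ((b * z).conj * b).conj = z := by
    rw [Oct.conj_mul, Oct.conj_conj, Oct.conj_mul_cancel, hb, one_smul]
  rw [A2_apply]
  simp only [h1_xi0, h1_xi1, h1_xi2, h1_x0, h1_x1, h1_x2, Oct.ip_smul, hb, mul_add, add_mul,
    mul_smul_comm, smul_mul_assoc, Oct.conj_add, Oct.conj_smul, hx, hz]
  congr 1
  · ring
  · ring
  · module
  · module
  · module

theorem mul_self_of_im {p : Oct ℝ} (hp : p.c 0 = 0) (hu : p.ip p = 1) : p * p = (-1 : ℝ) • 1 := by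
  have h := Oct.conj_mul_cancel p 1
  have hc : p.conj = -p := by
    apply Oct.ext8 <;> simp [Oct.conj_c, hp]
  rw [mul_one, hc, hu, one_smul, neg_mul] at h
  rw [← h]; module

theorem exp_rot_apply {p : Oct ℝ} (hp : p.c 0 = 0) (hu : p.ip p = 1) (a b c r s φ ψ t : ℝ) :
    NormedSpace.exp (t • rot p) (h1 a b c 0 (r • (Real.cos ψ • 1 + Real.sin ψ • p))
        (s • (Real.cos φ • 1 + Real.sin φ • p))) =
      h1 a b c 0 (r • (Real.cos (ψ + t) • 1 + Real.sin (ψ + t) • p))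
        (s • (Real.cos (φ - 2 * t) • 1 + Real.sin (φ - 2 * t) • p)) := by
  refine exp_apply_eq (γ := fun t => h1 a b c 0
    (r • (Real.cos (ψ + t) • 1 + Real.sin (ψ + t) • p))
    (s • (Real.cos (φ - 2 * t) • 1 + Real.sin (φ - 2 * t) • p))) (fun u => ?_) (by simp) t
  have l1 : HasDerivAt (fun u : ℝ => ψ + u) 1 u := (hasDerivAt_id u).const_add ψ
  have l2 : HasDerivAt (fun u : ℝ => φ - 2 * u) (-2) u := by
    simpa using ((hasDerivAt_id u).const_mul 2).const_sub φ
  refine (hasDerivAt_h1 (hasDerivAt_const u a) (hasDerivAt_const u b) (hasDerivAt_const u c)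
    (hasDerivAt_const u 0)
    (((l1.cos.smul_const (1 : Oct ℝ)).add (l1.sin.smul_const p)).const_smul r)
    (((l2.cos.smul_const (1 : Oct ℝ)).add (l2.sin.smul_const p)).const_smul s)).congr_deriv ?_
  have hp1 : p.ip 1 = 0 := by rw [Oct.ip_comm, Oct.one_ip, hp]
  rw [rot_apply hp]
  simp only [h1_xi0, h1_xi1, h1_xi2, h1_x0, h1_x1, h1_x2, Oct.ip_smul, Oct.ip_add, hu, hp1,
    mul_zero, add_mul, smul_mul_assoc, one_mul, mul_self_of_im hp hu, Oct.smul_c, Oct.add_c,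
    Oct.one_c, Pi.smul_apply, Pi.add_apply, smul_eq_mul, hp, Matrix.cons_val_zero]
  congr 1
  · module
  · module

/-- Every octonion lies in a copy `ℝ + ℝ p` of the complex numbers. The modulus `s` may be negative,
so that `ξ₂` or `ξ₃` itself can serve as `s`. -/
theorem exists_polar {z : Oct ℝ} {s : ℝ} (hs : s ≠ 0) (hz : z.ip z = s ^ 2) :
    ∃ (p : Oct ℝ) (φ : ℝ), p.c 0 = 0 ∧ p.ip p = 1 ∧
      z = s • (Real.cos φ • 1 + Real.sin φ • p) := by
  set c := s⁻¹ * z.c 0 with hc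
  set q : Oct ℝ := s⁻¹ • z - c • 1 with hq
  have q0 : q.c 0 = 0 := by rw [hq]; simp [hc]
  have hzq : z = s • (c • 1 + q) := by
    rw [hq, add_sub_cancel, smul_smul, mul_inv_cancel₀ hs, one_smul]
  have q1 : Oct.ip 1 q = 0 := by rw [Oct.one_ip, q0]
  have hn : c ^ 2 + q.ip q = 1 := by
    have e := hz
    rw [hzq] at e
    simp only [Oct.ip_smul, Oct.smul_ip, Oct.ip_add, Oct.add_ip, q1, Oct.ip_comm q 1,
      Oct.one_ip, Oct.one_c, Matrix.cons_val_zero] at e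
    have hs2 : s ^ 2 ≠ 0 := pow_ne_zero 2 hs
    have : s ^ 2 * (c ^ 2 + q.ip q - 1) = 0 := by linear_combination e
    have := (mul_eq_zero.1 this).resolve_left hs2
    linarith
  have nn := Oct.ip_self_nonneg q
  have c1 : -1 ≤ c := by nlinarith
  have c2 : c ≤ 1 := by nlinarith
  set r := Real.sqrt (q.ip q) with hr
  have hsin : Real.sin (Real.arccos c) = r := by
    rw [Real.sin_arccos, hr]; congr 1; linarith
  by_cases hr0 : r = 0
  · have hq0 : q = 0 := Oct.ip_self_eq_zero ((Real.sqrt_eq_zero nn).1 hr0)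
    -- For real `z` the direction `p` is arbitrary, and `e₁` is taken.
    refine ⟨e1, Real.arccos c, by simp [e1], by simp [Oct.ip_eq, e1], ?_⟩
    rw [Real.cos_arccos c1 c2, hsin, hr0, zero_smul, hzq, hq0]
  · refine ⟨r⁻¹ • q, Real.arccos c, by simp [q0], ?_, ?_⟩
    · rw [Oct.ip_smul, Oct.smul_ip, ← Real.mul_self_sqrt nn, ← hr]
      field_simp
    · rw [Real.cos_arccos c1 c2, hsin, smul_smul, mul_inv_cancel₀ hr0, one_smul, ← hzq]

/-! ### The group `K_ε` -/

theorem lieKeps_subset_f4 {X : EndJ} (h : X ∈ lieKeps) : X ∈ f4 := by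
  obtain ⟨H, ⟨s, rfl⟩, D, hD, U₁, hU₁, U₂, hU₂, V₁, hV₁, V₂, hV₂, rfl, -⟩ := h
  refine mem_f4_iff.2 ?_
  exact ((((((A3_isDer 1).smul s).add (mem_f4_iff.1 hD.1)).add (mem_f4_iff.1 hU₁.1)).add
    (mem_f4_iff.1 hU₂.1)).add (mem_f4_iff.1 hV₁.1)).add (mem_f4_iff.1 hV₂.1)

theorem grpKeps0_prop {g : EndJˣ} (h : g ∈ grpKeps0) : g ∈ F4 ∧ (g : EndJ) E2 = E2 := by
  induction h using Subgroup.closure_induction with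
  | mem x hx =>
    obtain ⟨D, hD, rfl⟩ := hx
    refine ⟨expU_mem_F4 (lieKeps_subset_f4 hD), ?_⟩
    have := exp_apply_eq_self (lieKeps_E2 hD) 1
    rwa [one_smul] at this
  | one => exact ⟨F4.one_mem, rfl⟩
  | mul x y _ _ hx hy =>
    exact ⟨F4.mul_mem hx.1 hy.1, by rw [units_mul_apply, hy.2, hx.2]⟩
  | inv x _ hx => exact ⟨F4.inv_mem hx.1, units_inv_fix hx.2⟩

theorem grpKeps_prop {g : EndJˣ} (h : g ∈ grpKeps) : g ∈ F4 ∧ (g : EndJ) E2 = E2 := by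
  obtain ⟨k, hk, m, hm, rfl⟩ := h
  have hk' := grpKeps0_prop hk
  exact ⟨F4.mul_mem hk'.1 hm.1.1, by rw [units_mul_apply, grpM_E2 hm, hk'.2]⟩

theorem grpKeps0_subset {g : EndJˣ} (h : g ∈ grpKeps0) : g ∈ grpKeps :=
  ⟨g, h, 1, one_mem_grpM, mul_one g⟩

theorem grpKeps_mul_grpM : grpKeps * grpM = grpKeps := by
  have : grpM * grpM = grpM := by
    ext g
    constructor
    · rintro ⟨a, ha, b, hb, rfl⟩
      exact grpM_mul ha hb
    · exact fun h => ⟨g, h, 1, one_mem_grpM, mul_one g⟩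
  rw [grpKeps, mul_assoc, this]

theorem expU_smul_mem_grpKeps0 {D : EndJ} (h : D ∈ lieKeps) (t : ℝ) : expU (t • D) ∈ grpKeps0 :=
  Subgroup.subset_closure ⟨_, smul_mem_lieKeps h t, rfl⟩

/-- The coordinate equations for elements with square zero. -/
theorem sq_zero_eqs {X : J} (h : jmul X X = 0) :
    X.1 0 ^ 2 = (X.2 1).ip (X.2 1) + (X.2 2).ip (X.2 2) ∧
    X.1 1 ^ 2 + (X.2 0).ip (X.2 0) = (X.2 2).ip (X.2 2) ∧
    X.1 2 ^ 2 + (X.2 0).ip (X.2 0) = (X.2 1).ip (X.2 1) ∧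
    (X.1 1 + X.1 2) • X.2 0 = (X.2 1 * X.2 2).conj ∧
    (X.1 2 + X.1 0) • X.2 1 = -(X.2 2 * X.2 0).conj ∧
    (X.1 0 + X.1 1) • X.2 2 = -(X.2 0 * X.2 1).conj := by
  rw [jmul, ← h1_zero] at h
  have a0 := congrArg (fun X : J => X.1 0) h
  have a1 := congrArg (fun X : J => X.1 1) h
  have a2 := congrArg (fun X : J => X.1 2) h
  have b0 := congrArg (fun X : J => X.2 0) h
  have b1 := congrArg (fun X : J => X.2 1) h
  have b2 := congrArg (fun X : J => X.2 2) h
  simp only [h1_xi0, h1_xi1, h1_xi2, h1_x0, h1_x1, h1_x2, Oct.conj_add] at a0 a1 a2 b0 b1 b2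
  refine ⟨by linarith, by linarith, by linarith, ?_, ?_, ?_⟩
  · linear_combination (norm := module) b0
  · linear_combination (norm := module) b1
  · linear_combination (norm := module) b2

/-- The elements with square zero and `ξ₂ ≠ 0` are `K_ε`-conjugate to multiples of `P⁻`. -/
theorem exists_Keps_smul_Pminus {X : J} (h : jmul X X = 0) (h2 : X.1 1 ≠ 0) :
    ∃ k ∈ grpKeps0, ∃ s : ℝ, s ≠ 0 ∧ (k : EndJ) X = s • Pminus := by
  obtain ⟨k₁, hk₁, hx⟩ : ∃ k ∈ grpKeps0, ((k : EndJ) X).2 1 = 0 := by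
    by_cases hx : X.2 1 = 0
    · exact ⟨1, grpKeps0.one_mem, hx⟩
    obtain ⟨a0, a1, a2, -, b1, -⟩ := sq_zero_eqs h
    have n1 := congrArg (fun x : Oct ℝ => x.ip x) b1
    simp only [← neg_one_smul ℝ (X.2 2 * X.2 0).conj, Oct.ip_smul, Oct.smul_ip, Oct.ip_conj_conj,
      Oct.ip_mul_self] at n1
    set N := (X.2 1).ip (X.2 1) with hN
    have Npos : 0 < N := lt_of_le_of_ne (Oct.ip_self_nonneg _)
      fun h => hx (Oct.ip_self_eq_zero h.symm)
    -- Taking norms in `b1` and eliminating the norms of `x₁` and `x₃` leaves the perfect square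
    -- `(ξ₁ ξ₃ + N)² = 0`.
    have q : X.1 0 * X.1 2 = -N := by
      have : (X.1 0 * X.1 2 + N) ^ 2 = 0 := by
        have e0 : X.1 0 ^ 2 * X.1 2 ^ 2 = X.1 0 ^ 2 * (N - (X.2 0).ip (X.2 0)) := by
          rw [← a2]; ring
        linear_combination e0 + n1 - N * a2 - N * a0 - (X.2 0).ip (X.2 0) * a0 + N * a0
      have := pow_eq_zero_iff (two_ne_zero) |>.1 this
      linarith
    set r := Real.sqrt N with hr
    have r2 : r ^ 2 = N := Real.sq_sqrt Npos.le
    have rpos : 0 < r := Real.sqrt_pos.2 Npos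
    set b := r⁻¹ • X.2 1 with hb
    have hb1 : b.ip b = 1 := by
      rw [hb, Oct.ip_smul, Oct.smul_ip, ← hN, ← r2]; field_simp
    have hxb : X.2 1 = r • b := by rw [hb, smul_smul, mul_inv_cancel₀ rpos.ne', one_smul]
    set m := (X.1 2 + X.1 0) / 2 with hm
    set d := (X.1 2 - X.1 0) / 2 with hd
    have hX : X = h1 (m - d) (X.1 1) (m + d) (X.2 0) (r • b) (X.2 2) := by
      conv_lhs => rw [← h1_eta X]
      rw [hxb, hm, hd]
      congr 1 <;> ring
    -- Here `d² - r² = ξ₂² / 4`; this is where `ξ₂ ≠ 0` lets a hyperbolic rotation annihilate `x₂`.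
    have dr : 0 < (d - r) * (d + r) := by
      have : (d - r) * (d + r) = X.1 1 ^ 2 / 4 := by
        rw [hd]
        linear_combination (1 / 4 : ℝ) * a0 + (1 / 4 : ℝ) * a2 - (1 / 4 : ℝ) * a1
          - (1 / 2 : ℝ) * q - r2
      rw [this]; positivity
    have hne : d + r ≠ 0 := fun h0 => by rw [h0, mul_zero] at dr; exact lt_irrefl _ dr
    have qpos : 0 < (d - r) / (d + r) := by
      rw [show (d - r) / (d + r) = (d - r) * (d + r) / (d + r) ^ 2 by field_simp]
      positivity
    -- The solution of `r cosh 2t + d sinh 2t = 0`, that is, of `exp (4t) = (d - r) / (d + r)`.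
    set t := Real.log ((d - r) / (d + r)) / 4 with ht
    refine ⟨expU (t • A2 b), expU_smul_mem_grpKeps0 (A2_mem_lieKeps b) t, ?_⟩
    rw [expU_val, hX, exp_A2_apply hb1, h1_x1]
    have hE : Real.exp (2 * t) * Real.exp (2 * t) = (d - r) / (d + r) := by
      rw [← Real.exp_add, show 2 * t + 2 * t = Real.log ((d - r) / (d + r)) by rw [ht]; ring,
        Real.exp_log qpos]
    have hE' : Real.exp (2 * t) * Real.exp (-(2 * t)) = 1 := by
      rw [← Real.exp_add, add_neg_cancel, Real.exp_zero]
    have hz : r * Real.cosh (2 * t) + d * Real.sinh (2 * t) = 0 := by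
      rw [Real.cosh_eq, Real.sinh_eq]
      rw [eq_div_iff hne] at hE
      have : Real.exp (2 * t) * (r * ((Real.exp (2 * t) + Real.exp (-(2 * t))) / 2)
          + d * ((Real.exp (2 * t) - Real.exp (-(2 * t))) / 2)) = 0 := by
        linear_combination (1 / 2 : ℝ) * hE + ((r - d) / 2) * hE'
      exact (mul_eq_zero.1 this).resolve_left (Real.exp_pos _).ne'
    rw [hz, zero_smul]
  obtain ⟨f1, g1⟩ := grpKeps0_prop hk₁
  have hsq : jmul ((k₁ : EndJ) X) ((k₁ : EndJ) X) = 0 := by rw [← F4_jmul f1, h, map_zero]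
  have hne : ((k₁ : EndJ) X).1 1 ≠ 0 := by rwa [xi_of_fix_E2 f1 g1]
  generalize hY : (k₁ : EndJ) X = Y at hx hsq hne
  obtain ⟨a0, a1, a2, -, -, b2⟩ := sq_zero_eqs hsq
  rw [hx, Oct.ip_zero] at a0 a2
  rw [hx, mul_zero, Oct.conj_zero, neg_zero] at b2
  -- With `x₂ = 0`, the equation `ξ₃² + (x₁ | x₁) = 0` kills both `x₁` and `ξ₃`.
  have y0 : Y.2 0 = 0 := Oct.ip_self_eq_zero
    (le_antisymm (by nlinarith [sq_nonneg (Y.1 2)]) (Oct.ip_self_nonneg _))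
  rw [y0, Oct.ip_zero] at a1 a2
  have c2 : Y.1 2 = 0 := pow_eq_zero_iff two_ne_zero |>.1 (by linarith)
  have nz : (Y.2 2).ip (Y.2 2) = Y.1 1 ^ 2 := by linarith
  have z0 : Y.2 2 ≠ 0 := fun h0 => hne (pow_eq_zero_iff two_ne_zero |>.1 (by
    rw [← nz, h0, Oct.ip_zero]))
  have c0 : Y.1 0 = -Y.1 1 := by
    have := (smul_eq_zero.1 b2).resolve_right z0
    linarith
  obtain ⟨p, φ, hp, hu, hz⟩ := exists_polar hne nz
  -- `exp (t rot p)` lowers the phase of `x₃` by `2t`, so `t = φ / 2` makes `x₃` real.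
  refine ⟨expU ((φ / 2) • rot p) * k₁,
    grpKeps0.mul_mem (expU_smul_mem_grpKeps0 (rot_mem_lieKeps hp) _) hk₁, Y.1 1, hne, ?_⟩
  have e := exp_rot_apply hp hu (Y.1 0) (Y.1 1) (Y.1 2) 0 (Y.1 1) φ 0 (φ / 2)
  rw [← hz, zero_smul, zero_smul] at e
  rw [units_mul_apply, hY, expU_val]
  conv_lhs => rw [← h1_eta Y, hx, y0]
  rw [e, c0, c2, Pminus, smul_h1, show φ - 2 * (φ / 2) = 0 by ring]
  simp

/-- The elements with square zero and `ξ₂ = 0` are `K_ε`-conjugate to multiples of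
`h¹(-1, 0, 1; 0, 1, 0)`. -/
theorem exists_Keps_smul_of_xi_eq_zero {X : J} (hX : X ≠ 0) (h : jmul X X = 0) (h2 : X.1 1 = 0) :
    ∃ k ∈ grpKeps0, ∃ s : ℝ, s ≠ 0 ∧ (k : EndJ) X = s • h1 (-1) 0 1 0 1 0 := by
  obtain ⟨a0, a1, a2, b0, b1, -⟩ := sq_zero_eqs h
  have n0 := congrArg (fun x : Oct ℝ => x.ip x) b0
  simp only [Oct.ip_smul, Oct.smul_ip, Oct.ip_conj_conj, Oct.ip_mul_self, h2] at n0
  rw [h2] at a1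
  -- For `ξ₂ = 0` the vectors `x₁` and `x₃` have equal norm; the norm of `b0` then reads `(x₁ | x₁)²
  -- = 0`.
  have x0 : X.2 0 = 0 := by
    refine Oct.ip_self_eq_zero (pow_eq_zero_iff two_ne_zero |>.1 ?_)
    have : (X.2 2).ip (X.2 2) = (X.2 0).ip (X.2 0) := by linarith
    rw [this, ← a2] at n0
    linear_combination -n0
  rw [x0, Oct.ip_zero] at a1 a2
  have x2 : X.2 2 = 0 := Oct.ip_self_eq_zero (by linarith)
  rw [x0, mul_zero, Oct.conj_zero, neg_zero] at b1
  rw [x2, Oct.ip_zero] at a0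
  have hne : X.1 2 ≠ 0 := fun h0 => hX (by
    rw [h0] at a2
    have x1 : X.2 1 = 0 := Oct.ip_self_eq_zero (by linarith)
    rw [x1, Oct.ip_zero] at a0
    exact J_ext (pow_eq_zero_iff two_ne_zero |>.1 (by linarith)) h2 h0 x0 x1 x2)
  have nz : (X.2 1).ip (X.2 1) = X.1 2 ^ 2 := by linarith
  have z0 : X.2 1 ≠ 0 := fun h0 => hne (pow_eq_zero_iff two_ne_zero |>.1 (by
    rw [← nz, h0, Oct.ip_zero]))
  have c0 : X.1 0 = -X.1 2 := by
    have := (smul_eq_zero.1 b1).resolve_right z0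
    linarith
  obtain ⟨p, φ, hp, hu, hz⟩ := exists_polar hne nz
  -- On `x₂` the phase grows by `t`, hence the parameter `-φ`.
  refine ⟨expU ((-φ) • rot p), expU_smul_mem_grpKeps0 (rot_mem_lieKeps hp) _, X.1 2, hne, ?_⟩
  have e := exp_rot_apply hp hu (X.1 0) (X.1 1) (X.1 2) (X.1 2) 0 0 φ (-φ)
  rw [← hz, zero_smul, zero_smul] at e
  rw [expU_val]
  conv_lhs => rw [← h1_eta X, x2, x0]
  rw [e, c0, h2, smul_h1, add_neg_cancel]
  simp

/-! ### The decomposition -/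

theorem exp_A1_one_Pminus (t : ℝ) : NormedSpace.exp (t • A1 1) Pminus =
    h1 (-1) (Real.cos t ^ 2) (Real.sin t ^ 2) (-(Real.sin t * Real.cos t) • 1)
      (-Real.sin t • 1) (Real.cos t • 1) := by
  refine exp_apply_eq (γ := fun t => h1 (-1) (Real.cos t ^ 2) (Real.sin t ^ 2)
    (-(Real.sin t * Real.cos t) • 1) (-Real.sin t • 1) (Real.cos t • 1)) (fun u => ?_)
    (by simp [Pminus]) t
  have hc := Real.hasDerivAt_cos u
  have hs := Real.hasDerivAt_sin u
  refine (hasDerivAt_h1 (hasDerivAt_const u (-1)) (hc.pow 2) (hs.pow 2)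
    ((hs.mul hc).neg.smul_const (1 : Oct ℝ)) (hs.neg.smul_const (1 : Oct ℝ))
    (hc.smul_const (1 : Oct ℝ))).congr_deriv ?_
  rw [A1_apply]
  simp only [h1_xi0, h1_xi1, h1_xi2, h1_x0, h1_x1, h1_x2, Oct.ip_smul, Oct.one_ip, Oct.one_c,
    Matrix.cons_val_zero, mul_one, one_mul, Oct.conj_smul, Oct.conj_one]
  congr 1
  · simp; ring
  · simp; ring
  · congr 1; ring
  · module

/-- The rotation by `-π/2` trades `ξ₂` for `ξ₃` and `x₃` for `x₂`, which gives the normal form of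
the orbit with `ξ₂ = 0`. -/
theorem weyl_Pminus : (expU (-(2⁻¹ * Real.pi) • A1 1) : EndJ) Pminus = h1 (-1) 0 1 0 1 0 := by
  have h : Real.cos (-(2⁻¹ * Real.pi)) = 0 := by
    rw [Real.cos_neg, show 2⁻¹ * Real.pi = Real.pi / 2 by ring, Real.cos_pi_div_two]
  have h' : Real.sin (-(2⁻¹ * Real.pi)) = -1 := by
    rw [Real.sin_neg, show 2⁻¹ * Real.pi = Real.pi / 2 by ring, Real.sin_pi_div_two]
  rw [expU_val, exp_A1_one_Pminus, h, h']
  simp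

theorem weyl_mem_F4 : expU (-(2⁻¹ * Real.pi) • A1 1) ∈ F4 :=
  expU_mem_F4 (mem_f4_iff.2 ((A1_isDer 1).smul _))

theorem expU_A3_mem_grpA (t : ℝ) : expU (t • A3 1) ∈ grpA := ⟨_, ⟨t, rfl⟩, rfl⟩

theorem expU_A3_mem_F4 (t : ℝ) : expU (t • A3 1) ∈ F4 :=
  expU_mem_F4 (mem_f4_iff.2 ((A3_isDer 1).smul _))

theorem expU_A3_Pminus (t : ℝ) :
    (expU (t • A3 1) : EndJ) Pminus = Real.exp (t * 2) • Pminus :=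
  exp_apply_eigen A3_one_Pminus t

theorem grpA_prop {a : EndJˣ} (h : a ∈ grpA) :
    a ∈ F4 ∧ ∃ r : ℝ, 0 < r ∧ (a : EndJ) Pminus = r • Pminus := by
  obtain ⟨_, ⟨t, rfl⟩, rfl⟩ := h
  exact ⟨expU_A3_mem_F4 t, _, Real.exp_pos _, expU_A3_Pminus t⟩

theorem grpM_comm_grpA {m a : EndJˣ} (hm : m ∈ grpM) (ha : a ∈ grpA) : a * m = m * a := by
  obtain ⟨_, ⟨t, rfl⟩, rfl⟩ := ha
  have h : (m : EndJ) * (t • A3 1) * ((m⁻¹ : EndJˣ) : EndJ) = t • A3 1 := by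
    rw [mul_smul_comm, smul_mul_assoc, hm.2]
  let _ : NormedAlgebra ℚ EndJ := NormedAlgebra.restrictScalars ℚ ℝ EndJ
  have h' := NormedSpace.exp_units_conj m (t • A3 1)
  rw [h] at h'
  have e : expU (t • A3 1) = m * expU (t • A3 1) * m⁻¹ := Units.ext h'
  rw [eq_mul_inv_iff_mul_eq] at e
  exact e

/-- Automorphisms mapping `P⁻` to a nonzero multiple of itself belong to `M A N⁺`. -/
theorem mem_MAN_of_Pminus_smul {g : EndJˣ} (hg : g ∈ F4) {s : ℝ} (hs : s ≠ 0)
    (h : (g : EndJ) Pminus = s • Pminus) : ∃ m ∈ grpM, ∃ a ∈ grpA, ∃ n ∈ grpN, g = m * a * n := by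
  have hpos := pos_of_Pminus_smul hg h hs
  set a := expU ((Real.log s / 2) • A3 1) with ha
  have haP : (a : EndJ) Pminus = s • Pminus := by
    rw [ha, expU_A3_Pminus, div_mul_cancel₀ _ two_ne_zero, Real.exp_log hpos]
  have haA : a ∈ grpA := expU_A3_mem_grpA _
  -- Dividing by the element of `A` that scales `P⁻` by the same `s` reduces to the stabilizer of
  -- `P⁻`.
  have hfix : ((a⁻¹ * g : EndJˣ) : EndJ) Pminus = Pminus := by
    rw [units_mul_apply, h, ← haP, units_inv_apply]
  obtain ⟨m, hm, n, hn, e⟩ := stabilizer_Pminus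
    (F4.mul_mem (F4.inv_mem (grpA_prop haA).1) hg) hfix
  refine ⟨m, hm, a, haA, n, hn, ?_⟩
  rw [← grpM_comm_grpA hm haA, mul_assoc, ← e, mul_inv_cancel_left]

theorem MAN_Pminus {m a n : EndJˣ} (hm : m ∈ grpM) (ha : a ∈ grpA) (hn : n ∈ grpN) :
    m * a * n ∈ F4 ∧ ∃ r : ℝ, 0 < r ∧ ((m * a * n : EndJˣ) : EndJ) Pminus = r • Pminus := by
  obtain ⟨ha', r, hr, e⟩ := grpA_prop ha
  refine ⟨F4.mul_mem (F4.mul_mem hm.1.1 ha') (grpN_mem_F4 hn), r, hr, ?_⟩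
  rw [units_mul_apply, grpN_Pminus hn, units_mul_apply, e, map_smul, grpM_Pminus hm]

theorem inn_E2 (X : J) : inn X E2 = X.1 1 := by
  rw [inn, jmul_comm, jmul_E2, tr]; simp

/-- `M A N⁺` scales `P⁻` by a positive factor and `K_ε` preserves `ξ₂`, so `ξ₂` stays nonzero on the
cell. Conversely, some `k` in `(K_ε)⁰` brings `g P⁻` back to the line of `P⁻`, whence `k g ∈ M A
N⁺`. -/
theorem open_cell_eq : grpKeps * grpM * grpA * grpN =
    {g | g ∈ F4 ∧ inn ((g : EndJ) Pminus) E2 ≠ 0} := by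
  ext g
  constructor
  · rintro ⟨_, ⟨_, ⟨k, hk, m, hm, rfl⟩, a, ha, rfl⟩, n, hn, rfl⟩
    obtain ⟨hF, r, hr, e⟩ := MAN_Pminus hm ha hn
    obtain ⟨hk1, hk2⟩ := grpKeps_prop hk
    have assoc : k * m * a * n = k * (m * a * n) := by group
    change k * m * a * n ∈ _
    rw [assoc]
    refine ⟨F4.mul_mem hk1 hF, ?_⟩
    rw [inn_E2, units_mul_apply, e, xi_of_fix_E2 hk1 hk2, Pminus, smul_h1, h1_xi1, mul_one]
    exact hr.ne'
  · rintro ⟨hg, h⟩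
    rw [inn_E2] at h
    have sq : jmul ((g : EndJ) Pminus) ((g : EndJ) Pminus) = 0 := by
      rw [← F4_jmul hg, Pminus_sq, map_zero]
    obtain ⟨k, hk, s, hs, e⟩ := exists_Keps_smul_Pminus sq h
    obtain ⟨m, hm, a, ha, n, hn, e'⟩ := mem_MAN_of_Pminus_smul
      (F4.mul_mem (grpKeps0_prop hk).1 hg) hs (by rw [units_mul_apply, e])
    refine ⟨k⁻¹ * m * a, ⟨k⁻¹ * m, ⟨k⁻¹, grpKeps0_subset (grpKeps0.inv_mem hk), m, hm, rfl⟩,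
      a, ha, rfl⟩, n, hn, ?_⟩
    change k⁻¹ * m * a * n = g
    rw [mul_assoc k⁻¹, mul_assoc k⁻¹, ← e', inv_mul_cancel_left]

/-- The same argument, with base point `w P⁻` for the rotation `w`: here `w⁻¹ k g` preserves the
line of `P⁻`. -/
theorem closed_cell_eq : grpKeps * {expU (-(2⁻¹ * Real.pi) • A1 1)} * grpM * grpA * grpN =
    {g | g ∈ F4 ∧ inn ((g : EndJ) Pminus) E2 = 0} := by
  ext g
  have hw := weyl_Pminus
  have hwF := weyl_mem_F4
  generalize expU (-(2⁻¹ * Real.pi) • A1 1) = w at hw hwF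
  constructor
  · rintro ⟨_, ⟨_, ⟨_, ⟨k, hk, _, rfl, rfl⟩, m, hm, rfl⟩, a, ha, rfl⟩, n, hn, rfl⟩
    obtain ⟨hF, r, hr, e⟩ := MAN_Pminus hm ha hn
    obtain ⟨hk1, hk2⟩ := grpKeps_prop hk
    rename_i w
    have assoc : k * w * m * a * n = k * (w * (m * a * n)) := by group
    change k * w * m * a * n ∈ _
    rw [assoc]
    refine ⟨F4.mul_mem hk1 (F4.mul_mem hwF hF), ?_⟩
    rw [inn_E2, units_mul_apply, units_mul_apply, e, xi_of_fix_E2 hk1 hk2, map_smul, hw, smul_h1,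
      h1_xi1, mul_zero]
  · rintro ⟨hg, h⟩
    rw [inn_E2] at h
    have sq : jmul ((g : EndJ) Pminus) ((g : EndJ) Pminus) = 0 := by
      rw [← F4_jmul hg, Pminus_sq, map_zero]
    have ne : (g : EndJ) Pminus ≠ 0 := fun h0 => Pminus_ne_zero (by
      rw [← units_inv_apply g Pminus, h0, map_zero])
    obtain ⟨k, hk, s, hs, e⟩ := exists_Keps_smul_of_xi_eq_zero ne sq h
    obtain ⟨m, hm, a, ha, n, hn, e'⟩ := mem_MAN_of_Pminus_smul
      (g := w⁻¹ * (k * g)) (F4.mul_mem (F4.inv_mem hwF) (F4.mul_mem (grpKeps0_prop hk).1 hg)) hs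
      (by rw [units_mul_apply, units_mul_apply, e, ← hw, map_smul, units_inv_apply])
    refine ⟨k⁻¹ * w * m * a, ⟨k⁻¹ * w * m, ⟨k⁻¹ * w,
      ⟨k⁻¹, grpKeps0_subset (grpKeps0.inv_mem hk), w, rfl, rfl⟩, m, hm, rfl⟩,
      a, ha, rfl⟩, n, hn, ?_⟩
    change k⁻¹ * w * m * a * n = g
    rw [mul_assoc (k⁻¹ * w), mul_assoc (k⁻¹ * w), ← e']
    group

end F4m20

end

open F4m20
theorem theorem9p8 :
    (F4 : Set EndJˣ) =
        grpKeps * grpM * grpA * grpN ∪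
          grpKeps * {expU (-(2⁻¹ * Real.pi) • A1 1)} * grpM * grpA * grpN ∧
      Disjoint (grpKeps * grpM * grpA * grpN)
        (grpKeps * {expU (-(2⁻¹ * Real.pi) • A1 1)} * grpM * grpA * grpN) ∧
      grpKeps * grpM * grpA * grpN = grpKeps * grpA * grpN ∧
      grpKeps * {expU (-(2⁻¹ * Real.pi) • A1 1)} * grpM * grpA * grpN =
        {g | g ∈ F4 ∧ inn ((g : EndJ) Pminus) E2 = 0} := by
  -- Once the cells are the sets `ξ₂ ≠ 0` and `ξ₂ = 0`, covering and disjointness are immediate;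
  -- `K_ε M = K_ε` since `M` is closed under products.
  refine ⟨?_, ?_, by rw [grpKeps_mul_grpM], closed_cell_eq⟩
  · rw [open_cell_eq, closed_cell_eq]
    ext g
    constructor
    · intro hg
      by_cases h : inn ((g : EndJ) Pminus) E2 = 0
      · exact Or.inr ⟨hg, h⟩
      · exact Or.inl ⟨hg, h⟩
    · rintro (h | h)
      · exact h.1
      · exact h.1
  · rw [open_cell_eq, closed_cell_eq]
    exact Set.disjoint_left.2 fun g h h' => h.2 h'.2
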